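/- Let $t\in\mathbb{C}\setminus\{0\}$, let $0<r<\tfrac12$, and let $\varepsilon=e^{2\pi i/3}$. Let $L=K_{\mathbb{C}P^1}(0+1+\infty)$, and write points of $\operatorname{Tot}L$ as $\zeta\,\frac{dz}{z(z-1)}$ over $z\in\mathbb{C}$ and as $\eta\,\frac{dw}{w(w-1)}$ over $w=1/z$ near $z=\infty$ (so that $\eta=w\zeta$). Let $$\Sigma=\Sigma_t=\{(z,\zeta)\in\mathbb{C}^2:\ \zeta^3+t\,z(z-1)=0\}\subset\operatorname{Tot}L$$ be the spectral curve, and let $\widetilde\Sigma=\widetilde\Sigma_t\subset\operatorname{Tot}L$ be its smooth compactification of genus $1$, given near $z=\infty$ by $\eta^3+t\,w(1-w)=0$, i.e. obtained by adding the point $(w,\eta)=(0,0)$. Over the segment $[r,1-r]\subset\mathbb{R}$ the curve $\Sigma$ has three sheets $\Sigma_1,\Sigma_2,\Sigma_3$, on which $\zeta$ equals $\xi,\ \varepsilon\xi,\ \varepsilon^2\xi$ respectively, where $\xi$ is a continuous solution of $\xi^3+tz(z-1)=0$ (any of the three). Let $f_j$ be the lift to $\Sigma_j$ of this segment, traversed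 from $1-r$ to $r$. Let $\gamma_0(s)=re^{2\pi i s}$ and $\gamma_1(s)=1-re^{2\pi i s}$, $s\in[0,1]$, be the positively oriented circles of radius $r$ around $0$ and $1$, based at $r$ and $1-r$. For $P\in\{0,1\}$ the loop $\gamma_P$ has a lift $\tilde\gamma_P$ to $\Sigma$ that goes from the sheet $\Sigma_1$ to the sheet $\Sigma_2$, and a lift $\tilde{\tilde\gamma}_P$ that goes from $\Sigma_2$ to $\Sigma_3$. Write $*$ for concatenation and $-$ for reversal of paths, and let $$A=\big[f_1*\tilde\gamma_0*(-f_2)*(-\tilde\gamma_1)\big],\qquad B=\big[f_2*\tilde{\tilde\gamma}_0*(-f_3)*(-\tilde{\tilde\gamma}_1)\big]$$ be the classes in the singular homology group $H_1(\widetilde\Sigma,\mathbb{Z})$ of these closed paths. Then such lifts exist, and for every choice of them (that is, of $\xi$), $A,B$ form a $\mathbb{Z}$-basis of $H_1(\widetilde\Sigma,\mathbb{Z})$. -/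

import Mathlib

open CategoryTheory AlgebraicTopology

noncomputable section

namespace SpectralCurve

/-! ### Singular homology classes of loops -/

/-- The first singular homology group `H₁(X, ℤ)` of a topological space. -/
abbrev H1 (X : Type) [TopologicalSpace X] : ModuleCat.{0} ℤ :=
  ((singularHomologyFunctor (ModuleCat.{0} ℤ) 1).obj (ModuleCat.of ℤ ℤ)).obj (TopCat.of X)

open Simplicial in
/-- A path in `X`, viewed as a singular `1`-simplex of `X`. -/
def pathSimplex {X : Type} [TopologicalSpace X] {x y : X} (γ : Path x y) :
    (TopCat.toSSet.obj (TopCat.of X)) _⦋1⦌ :=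
  TopCat.toSSetObj₁Equiv.symm ((TopCat.pathEquiv (X := TopCat.of X)).symm γ).hom

/-- The singular chain complex of `X` with integral coefficients. -/
abbrev singularChains (X : Type) [TopologicalSpace X] : ChainComplex (ModuleCat.{0} ℤ) ℕ :=
  ((singularChainComplexFunctor (ModuleCat.{0} ℤ)).obj (ModuleCat.of ℤ ℤ)).obj (TopCat.of X)

/-- The map `ℤ → C₁(X, ℤ)` sending `1` to the singular `1`-simplex given by a path. -/
def pathChain {X : Type} [TopologicalSpace X] {x y : X} (γ : Path x y) :
    ModuleCat.of ℤ ℤ ⟶ (singularChains X).X 1 :=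
  (TopCat.toSSet.obj (TopCat.of X)).ιChainComplex (pathSimplex γ)

/-- The singular `1`-simplex given by a closed path is a cycle. -/
theorem pathChain_d {X : Type} [TopologicalSpace X] {x : X} (γ : Path x x) :
    pathChain γ ≫ (singularChains X).d 1 0 = 0 := by
  have h := SSet.ιChainComplex_d (R := ModuleCat.of ℤ ℤ) (TopCat.toSSet.obj (TopCat.of X))
    (n := 0) (pathSimplex γ)
  refine h.trans ?_
  have h0 : (TopCat.toSSet.obj (TopCat.of X)).δ 0 (pathSimplex γ) =
      (TopCat.toSSet.obj (TopCat.of X)).δ 1 (pathSimplex γ) := by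
    unfold pathSimplex
    rw [TopCat.δ_zero_toSSetObj₁Equiv.symm, TopCat.δ_one_toSSetObj₁Equiv.symm,
      TopCat.Path.hom₀, TopCat.Path.hom₁]
  rw [Fin.sum_univ_two, h0]
  simp
  rfl

/-- The class in `H₁(X, ℤ)` of a closed path in `X`. -/
def loopClass {X : Type} [TopologicalSpace X] {x : X} (γ : Path x x) : H1 X :=
  ((singularChains X).liftCycles (pathChain γ) 0 (by simp) (pathChain_d γ) ≫
    (singularChains X).homologyπ 1).hom (1 : ℤ)

/-! ### The spectral curve -/

/-- The primitive cubic root of unity `ε = e^{2πi/3}`. -/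
def ε : ℂ := Complex.exp (2 * Real.pi * Complex.I / 3)

/-- Two points of two copies of `ℂ × ℂ` define the same point of the total space of `K(0 + 1 + ∞)`.
A point `(z, ζ)` of the first copy stands for the vector `ζ dz / (z (z - 1))` over `z ∈ ℂ`, and a
point `(w, η)` of the second copy stands for the vector `η dw / (w (w - 1))` over `z = 1 / w`.
As `dz / (z (z - 1)) = w · dw / (w (w - 1))`, these agree when `z w = 1` and `η = w ζ`. -/
def TotRel : (ℂ × ℂ) ⊕ (ℂ × ℂ) → (ℂ × ℂ) ⊕ (ℂ × ℂ) → Prop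
  | .inl a, .inl b => a = b
  | .inr a, .inr b => a = b
  | .inl a, .inr b => a.1 * b.1 = 1 ∧ b.2 = b.1 * a.2
  | .inr b, .inl a => a.1 * b.1 = 1 ∧ b.2 = b.1 * a.2

/-- The gluing relation is an equivalence relation. -/
theorem TotRel.equivalence : Equivalence TotRel where
  refl := by
    rintro (a | a)
    · exact Eq.refl a
    · exact Eq.refl a
  symm := by
    rintro (a | a) (b | b) h
    · exact Eq.symm h
    · exact h
    · exact h
    · exact Eq.symm h
  trans := by
    rintro (⟨a, u⟩ | ⟨a, u⟩) (⟨b, v⟩ | ⟨b, v⟩) (⟨c, x⟩ | ⟨c, x⟩) h k <;>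
      simp only [TotRel, Prod.mk.injEq] at h k ⊢ <;> grind

/-- The gluing relation as a setoid. -/
instance TotSetoid : Setoid ((ℂ × ℂ) ⊕ (ℂ × ℂ)) := ⟨TotRel, TotRel.equivalence⟩

/-- The total space `Tot L` of the line bundle `L = K(0 + 1 + ∞)` over `ℂP¹`, with the quotient
topology of its two standard charts. -/
def TotL : Type := Quotient TotSetoid

instance : TopologicalSpace TotL := inferInstanceAs (TopologicalSpace (Quotient TotSetoid))

/-- The chart of `Tot L` with coordinates `(z, ζ)`, over `ℂP¹ ∖ {∞}`. -/
def chartZ (a : ℂ × ℂ) : TotL := Quotient.mk TotSetoid (.inl a)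

/-- The chart of `Tot L` with coordinates `(w, η)`, over `ℂP¹ ∖ {0}`. -/
def chartW (a : ℂ × ℂ) : TotL := Quotient.mk TotSetoid (.inr a)

/-- The spectral curve `Σ_t = {(z, ζ) | ζ³ + t z (z - 1) = 0}`, in the chart `(z, ζ)`. -/
def affineCurve (t : ℂ) : Set (ℂ × ℂ) := {a | a.2 ^ 3 + t * (a.1 * (a.1 - 1)) = 0}

/-- The compactified spectral curve in `Tot L`: the curve given by `ζ³ + t z (z - 1) = 0` in the
chart `(z, ζ)`, and by the same equation `η³ + t w (1 - w) = 0` multiplied by `w³` in the chart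
`(w, η)`. The only point over `z = ∞` is `(w, η) = (0, 0)`. -/
def compactCurve (t : ℂ) : Set TotL :=
  chartZ '' affineCurve t ∪ chartW '' {b | b.2 ^ 3 + t * (b.1 * (1 - b.1)) = 0}

/-- The inclusion of the spectral curve `Σ_t` into its compactification. -/
def toCompact (t : ℂ) : C(affineCurve t, compactCurve t) where
  toFun a := ⟨chartZ a.1, Or.inl ⟨a.1, a.2, rfl⟩⟩
  continuous_toFun := Continuous.subtype_mk
    (continuous_quotient_mk'.comp (continuous_inl.comp continuous_subtype_val)) _

/-! ### The cycles `A` and `B` -/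

/-- The paths on the spectral curve `Σ_t` from which the cycles `A` and `B` are formed. The three
sheets are numbered `0, 1, 2`. -/
structure SheetLifts (t : ℂ) (r : ℝ) where
  /-- the points of the three sheets over `r` -/
  p : Fin 3 → affineCurve t
  /-- the points of the three sheets over `1 - r` -/
  q : Fin 3 → affineCurve t
  /-- the lifts of the segment, run through from `1 - r` to `r` -/
  f : ∀ j, Path (q j) (p j)
  f_lift : ∀ j s, (f j s).1.1 = (1 - (s : ℝ)) * (1 - r) + (s : ℝ) * r
  /-- over each point, the values of `ζ` on the three sheets are `ξ`, `ε ξ`, `ε² ξ` -/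
  f_sheet : ∀ j s, (f j s).1.2 = ε ^ (j : ℕ) * (f 0 s).1.2
  /-- the lift of the loop `γ₀(s) = r e^{2πis}` around `0` from the first to the second sheet -/
  γ0 : Path (p 0) (p 1)
  γ0_lift : ∀ s, (γ0 s).1.1 = r * Complex.exp (2 * Real.pi * Complex.I * (s : ℝ))
  /-- the lift of the loop `γ₀` from the second to the third sheet -/
  γ0' : Path (p 1) (p 2)
  γ0'_lift : ∀ s, (γ0' s).1.1 = r * Complex.exp (2 * Real.pi * Complex.I * (s : ℝ))
  /-- the lift of the loop `γ₁(s) = 1 - r e^{2πis}` around `1` from the first to the second sheet -/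
  γ1 : Path (q 0) (q 1)
  γ1_lift : ∀ s, (γ1 s).1.1 = 1 - r * Complex.exp (2 * Real.pi * Complex.I * (s : ℝ))
  /-- the lift of the loop `γ₁` from the second to the third sheet -/
  γ1' : Path (q 1) (q 2)
  γ1'_lift : ∀ s, (γ1' s).1.1 = 1 - r * Complex.exp (2 * Real.pi * Complex.I * (s : ℝ))

namespace SheetLifts

variable {t : ℂ} {r : ℝ} (D : SheetLifts t r)

/-- The closed path `f₁ * γ̃₀ * (-f₂) * (-γ̃₁)` on `Σ_t`. -/
def loopA : Path (D.q 0) (D.q 0) :=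
  (((D.f 0).trans D.γ0).trans (D.f 1).symm).trans D.γ1.symm

/-- The closed path `f₂ * γ̃̃₀ * (-f₃) * (-γ̃̃₁)` on `Σ_t`. -/
def loopB : Path (D.q 1) (D.q 1) :=
  (((D.f 1).trans D.γ0').trans (D.f 2).symm).trans D.γ1'.symm

/-- The class of the cycle `A` in the first homology of the compactified spectral curve. -/
def A : H1 (compactCurve t) := loopClass (D.loopA.map (toCompact t).continuous)

/-- The class of the cycle `B` in the first homology of the compactified spectral curve. -/
def B : H1 (compactCurve t) := loopClass (D.loopB.map (toCompact t).continuous)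

end SheetLifts

end SpectralCurve

end

/-! The argument takes place in the quotient Q of 1-chains by boundaries. H₁ embeds in Q, every path
has a class there whether closed or not, and concatenation becomes addition. A homomorphism D on Q
behaves like a closed 1-form: a primitive of D on U is a function g with D[γ] = g(end) - g(start)
for all paths in U. If D has a primitive on the whole space, it vanishes on H₁
(`IsPrimitiveOn.comp_homologyToChains`).

Generation. The compact curve is covered by its parts over ℂ ∖ [1, ∞), over ℂ ∖ (-∞, 0] and over |w|
< 1. Each contains one branch point, so a cube root of the base coordinate is a coordinate on it,
and D has a primitive there (`exists_isPrimitiveOn_disc`). The first two parts meet in three sheets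
over the doubly slit plane. The difference of their primitives is constant on each sheet, and D(A),
D(B) are, up to sign, the changes of this constant from sheet 1 to 2 and from 2 to 3. If both
vanish, the primitives glue; the part at infinity meets the rest in a path connected punctured disc
and adds no obstruction. Taking for D the quotient map of Q by the span of A and B puts H₁ inside
that span.

Independence. Instead of intersection numbers, winding numbers of circle-valued maps are used.
Choose κ with κ³ = t and put x = ζ/κ, so that x³ = z(1 - z). Up to positive denominators,
`nonvanishing` has real part |x + 1|² - 1 and imaginary part Re((z - 1/2) conj(x + 1)). It has no
zeros on the curve (`not_vanishing`) and tends to 1 at infinity, so its argument is a map F to the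
circle. The reflection z ↦ 1 - z with ζ fixed conjugates F, reverses each segment lift and exchanges
the lifts of the two circles. Hence half the winding along A or B is determined modulo 2π by the
values of F over z = 1/2 (`exp_half_winding_loop`). These are 1 on one sheet and -1 on the other
two, and κ decides which sheet is special. Two choices of κ give the windings (odd, even) and (odd,
odd) in units of 2π on (A, B). The determinant is odd, hence nonzero. -/

noncomputable section

namespace SpectralCurve

/-! ### Path classes modulo boundaries. -/

section Chains

variable {X : Type} [TopologicalSpace X]

/-- Singular `1`-chains modulo boundaries. -/
abbrev ChainsModBoundaries (X : Type) [TopologicalSpace X] : ModuleCat.{0} ℤ :=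
  (singularChains X).opcycles 1

/-- The class of a path in the `1`-chains modulo boundaries. -/
def pathClass {x y : X} (γ : Path x y) : ChainsModBoundaries X :=
  (pathChain γ ≫ (singularChains X).pOpcycles 1).hom (1 : ℤ)

/-- The embedding of the first homology into the `1`-chains modulo boundaries. -/
def homologyToChains (X : Type) [TopologicalSpace X] : H1 X →ₗ[ℤ] ChainsModBoundaries X :=
  ((singularChains X).homologyι 1).hom

theorem homologyToChains_injective : Function.Injective (homologyToChains X) :=
  (ModuleCat.mono_iff_injective ((singularChains X).homologyι 1)).1 inferInstance

/-- This lets a homology class of a closed path be computed from the classes of its non-closed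
pieces. -/
theorem homologyToChains_loopClass {x : X} (γ : Path x x) :
    homologyToChains X (loopClass γ) = pathClass γ := by
  have h : ((singularChains X).liftCycles (pathChain γ) 0 (by simp) (pathChain_d γ) ≫
    (singularChains X).homologyπ 1) ≫ (singularChains X).homologyι 1 =
      pathChain γ ≫ (singularChains X).pOpcycles 1 := by
    simp
  exact congrArg (fun f => f.hom (1 : ℤ)) h

open Simplicial in
/-- A continuous map from the standard triangle as a singular `2`-simplex. -/
def triangleSimplex (f : C(stdSimplex ℝ (Fin 3), X)) :
    (TopCat.toSSet.obj (TopCat.of X)) _⦋2⦌ :=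
  ((TopCat.of X).toSSetObjEquiv (.op ⦋2⦌)).symm f

/-- The `i`-th edge of a singular triangle, as a path. -/
def triangleEdge (f : C(stdSimplex ℝ (Fin 3), X)) (i : Fin 3) :
    Path (f (stdSimplex.map i.succAbove (stdSimplexHomeomorphUnitInterval.symm 0)))
      (f (stdSimplex.map i.succAbove (stdSimplexHomeomorphUnitInterval.symm 1))) where
  toFun s := f (stdSimplex.map i.succAbove (stdSimplexHomeomorphUnitInterval.symm s))
  continuous_toFun := f.continuous.comp
    ((stdSimplex.continuous_map _).comp stdSimplexHomeomorphUnitInterval.symm.continuous)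
  source' := rfl
  target' := rfl

open Simplicial in
theorem pathSimplex_eq {x y : X} (γ : Path x y) : pathSimplex γ =
    ((TopCat.of X).toSSetObjEquiv (.op ⦋1⦌)).symm
      (γ.toContinuousMap.comp ⟨_, stdSimplexHomeomorphUnitInterval.continuous⟩) := rfl

theorem δ_triangleSimplex (f : C(stdSimplex ℝ (Fin 3), X)) (i : Fin 3) :
    (TopCat.toSSet.obj (TopCat.of X)).δ i (triangleSimplex f) =
      pathSimplex (triangleEdge f i) := by
  rw [pathSimplex_eq]
  apply (TopCat.toSSetObjEquiv _ _).injective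
  refine ContinuousMap.ext fun z => ?_
  change f (stdSimplex.map i.succAbove z) = f (stdSimplex.map i.succAbove
    (stdSimplexHomeomorphUnitInterval.symm (stdSimplexHomeomorphUnitInterval z)))
  rw [Homeomorph.symm_apply_apply]

/-- The map `ℤ → C₂(X, ℤ)` given by a singular triangle. -/
def triangleChain (f : C(stdSimplex ℝ (Fin 3), X)) :
    ModuleCat.of ℤ ℤ ⟶ (singularChains X).X 2 :=
  (TopCat.toSSet.obj (TopCat.of X)).ιChainComplex (triangleSimplex f)

theorem triangleChain_d (f : C(stdSimplex ℝ (Fin 3), X)) :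
    triangleChain f ≫ (singularChains X).d 2 1 =
      pathChain (triangleEdge f 0) - pathChain (triangleEdge f 1) +
        pathChain (triangleEdge f 2) := by
  have h := SSet.ιChainComplex_d (R := ModuleCat.of ℤ ℤ) (TopCat.toSSet.obj (TopCat.of X))
    (n := 1) (triangleSimplex f)
  refine h.trans ?_
  simp only [δ_triangleSimplex]
  refine Eq.trans (b := ∑ i : Fin 3, (-1) ^ i.val • pathChain (triangleEdge f i)) rfl ?_
  rw [Fin.sum_univ_three]
  simp [sub_eq_add_neg]

theorem triangle_pathClass (f : C(stdSimplex ℝ (Fin 3), X)) :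
    pathClass (triangleEdge f 1) = pathClass (triangleEdge f 2) + pathClass (triangleEdge f 0) := by
  have h : (pathChain (triangleEdge f 0) - pathChain (triangleEdge f 1) +
        pathChain (triangleEdge f 2)) ≫ (singularChains X).pOpcycles 1 = 0 := by
    rw [← triangleChain_d, Category.assoc, HomologicalComplex.d_pOpcycles, Limits.comp_zero]
  rw [Preadditive.add_comp, Preadditive.sub_comp] at h
  have h3 : pathClass (triangleEdge f 0) - pathClass (triangleEdge f 1) +
      pathClass (triangleEdge f 2) = 0 := congrArg (fun g => g.hom (1 : ℤ)) h
  rw [← sub_eq_zero, ← neg_eq_zero, ← h3]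
  abel

/-- A path is determined, up to its class, by its underlying map. -/
theorem pathClass_congr {x y x' y' : X} {γ : Path x y} {γ' : Path x' y'}
    (h : ∀ s, γ s = γ' s) : pathClass γ = pathClass γ' := by
  have : pathSimplex γ = pathSimplex γ' := by
    rw [pathSimplex_eq, pathSimplex_eq]
    congr 2
    exact ContinuousMap.ext h
  unfold pathClass pathChain
  rw [this]

/-- The image of a segment under a continuous map. -/
abbrev segmentPath {E : Type*} [AddCommGroup E] [Module ℝ E] [TopologicalSpace E]
    [ContinuousAdd E] [ContinuousSMul ℝ E] (G : C(E, X)) (a b : E) : Path (G a) (G b) :=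
  (Path.segment a b).map G.continuous

/-- The image under G of the affine triangle abc is a singular 2-simplex with these edges. The
triangle may be degenerate: with E = ℝ the relation yields constants, concatenation and reversal,
and with E = ℝ × ℝ homotopies. -/
theorem pathClass_segment_add {E : Type*} [AddCommGroup E] [Module ℝ E] [TopologicalSpace E]
    [ContinuousAdd E] [ContinuousSMul ℝ E] (G : C(E, X)) (a b c : E) :
    pathClass (segmentPath G a b) + pathClass (segmentPath G b c) =
      pathClass (segmentPath G a c) := by
  let f : C(stdSimplex ℝ (Fin 3), X) :=
    ⟨fun x => G (x.1 0 • a + x.1 1 • b + x.1 2 • c), by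
      refine G.continuous.comp ?_
      have h : ∀ i, Continuous fun x : stdSimplex ℝ (Fin 3) => x.1 i := fun i =>
        (continuous_apply i).comp continuous_subtype_val
      exact (((h 0).smul continuous_const).add ((h 1).smul continuous_const)).add
        ((h 2).smul continuous_const)⟩
  have key : ∀ (i : Fin 3) (s : unitInterval) (k : Fin 3),
      (stdSimplex.map i.succAbove (stdSimplexHomeomorphUnitInterval.symm s)).1 k =
        (if i.succAbove 0 = k then 1 - (s : ℝ) else 0) +
          (if i.succAbove 1 = k then (s : ℝ) else 0) := by
    intro i s k
    have : (stdSimplex.map i.succAbove (stdSimplexHomeomorphUnitInterval.symm s)).1 k =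
      FunOnFinite.linearMap ℝ ℝ i.succAbove (stdSimplexHomeomorphUnitInterval.symm s).1 k := rfl
    rw [this, FunOnFinite.linearMap_apply_apply, Finset.sum_filter, Fin.sum_univ_two]
    rfl
  have e0 : pathClass (triangleEdge f 0) = pathClass (segmentPath G b c) := by
    refine pathClass_congr fun s => ?_
    change G (_ • a + _ • b + _ • c) = G (AffineMap.lineMap b c (s : ℝ))
    simp only [key, AffineMap.lineMap_apply_module]
    simp
  have e1 : pathClass (triangleEdge f 1) = pathClass (segmentPath G a c) := by
    refine pathClass_congr fun s => ?_
    change G (_ • a + _ • b + _ • c) = G (AffineMap.lineMap a c (s : ℝ))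
    simp [key, AffineMap.lineMap_apply_module, Fin.succAbove]
  have e2 : pathClass (triangleEdge f 2) = pathClass (segmentPath G a b) := by
    refine pathClass_congr fun s => ?_
    change G (_ • a + _ • b + _ • c) = G (AffineMap.lineMap a b (s : ℝ))
    simp [key, AffineMap.lineMap_apply_module, Fin.succAbove, Fin.lt_def]
  rw [← e0, ← e1, ← e2, triangle_pathClass]

end Chains

/-! ### Constant paths, concatenation and reversal. -/

section Paths

variable {X : Type} [TopologicalSpace X]

theorem pathClass_eq_zero_of_const {x y : X} (γ : Path x y) (h : ∀ s, γ s = x) :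
    pathClass γ = 0 := by
  have h1 := pathClass_segment_add (ContinuousMap.const ℝ x) 0 0 0
  have h2 : pathClass (segmentPath (ContinuousMap.const ℝ x) 0 0) = pathClass γ :=
    pathClass_congr fun s => (h s).symm
  rw [h2] at h1
  exact left_eq_add.1 h1.symm

/-- The extension of a path to the real line. -/
def extendMap {x y : X} (γ : Path x y) : C(ℝ, X) := ⟨γ.extend, γ.continuous_extend⟩

theorem extendMap_apply {x y : X} (γ : Path x y) (s : unitInterval) : extendMap γ s = γ s :=
  γ.extend_apply s.2

theorem pathClass_extendMap {x y : X} (γ : Path x y) :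
    pathClass (segmentPath (extendMap γ) 0 1) = pathClass γ := by
  refine pathClass_congr fun s => ?_
  change extendMap γ (AffineMap.lineMap (0 : ℝ) 1 (s : ℝ)) = γ s
  rw [← extendMap_apply]
  simp [AffineMap.lineMap_apply_module]

theorem pathClass_trans {x y z : X} (γ : Path x y) (γ' : Path y z) :
    pathClass (γ.trans γ') = pathClass γ + pathClass γ' := by
  rw [← pathClass_extendMap (γ.trans γ'), ← pathClass_segment_add _ _ (1 / 2 : ℝ)]
  congr 1
  · refine pathClass_congr fun s => ?_
    change extendMap (γ.trans γ') (AffineMap.lineMap (0 : ℝ) (1 / 2) (s : ℝ)) = γ s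
    have h : AffineMap.lineMap (0 : ℝ) (1 / 2) (s : ℝ) ∈ unitInterval := by
      simp [AffineMap.lineMap_apply_module]
      constructor <;> linarith [s.2.1, s.2.2]
    rw [extendMap_apply _ ⟨_, h⟩, Path.trans_apply, dif_pos]
    · congr 1
      ext
      simp [AffineMap.lineMap_apply_module]
      ring
    · simp [AffineMap.lineMap_apply_module]
      linarith [s.2.1, s.2.2]
  · refine pathClass_congr fun s => ?_
    change extendMap (γ.trans γ') (AffineMap.lineMap (1 / 2 : ℝ) 1 (s : ℝ)) = γ' s
    have h : AffineMap.lineMap (1 / 2 : ℝ) 1 (s : ℝ) ∈ unitInterval := by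
      simp [AffineMap.lineMap_apply_module]
      constructor <;> linarith [s.2.1, s.2.2]
    rw [extendMap_apply _ ⟨_, h⟩, Path.trans_apply]
    by_cases hs : (s : ℝ) = 0
    · obtain rfl : s = 0 := Subtype.ext hs
      rw [dif_pos (by simp)]
      simp
    · rw [dif_neg]
      · congr 1
        ext
        simp [AffineMap.lineMap_apply_module]
        ring
      · simp [AffineMap.lineMap_apply_module]
        have : 0 < (s : ℝ) := lt_of_le_of_ne s.2.1 (Ne.symm hs)
        linarith

/-- The degenerate triangle 0, 1, 0 has edges γ, its reverse and a constant path. -/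
theorem pathClass_symm {x y : X} (γ : Path x y) : pathClass γ.symm = -pathClass γ := by
  have h := pathClass_segment_add (extendMap γ) 0 1 0
  rw [pathClass_extendMap, pathClass_eq_zero_of_const (segmentPath (extendMap γ) 0 0)] at h
  · rw [eq_neg_iff_add_eq_zero, add_comm, ← h]
    congr 1
    refine pathClass_congr fun s => ?_
    change γ (unitInterval.symm s) = extendMap γ (AffineMap.lineMap (1 : ℝ) 0 (s : ℝ))
    rw [← extendMap_apply]
    simp [AffineMap.lineMap_apply_module]
  · intro s
    change extendMap γ (AffineMap.lineMap (0 : ℝ) 0 (s : ℝ)) = _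
    simp

end Paths

/-! ### Primitives of homomorphisms on 1-chains. -/

section Primitives

variable {X : Type} [TopologicalSpace X] {M : Type} [AddCommGroup M]

/-- The function `g` is a primitive on `U` of the homomorphism `D` on `1`-chains. -/
def IsPrimitiveOn (D : ChainsModBoundaries X →ₗ[ℤ] M) (U : Set X) (g : X → M) : Prop :=
  ∀ ⦃x y : X⦄ (γ : Path x y), (∀ s, γ s ∈ U) → D (pathClass γ) = g y - g x

variable {D : ChainsModBoundaries X →ₗ[ℤ] M} {U V : Set X} {g g' : X → M}

theorem IsPrimitiveOn.mono (h : IsPrimitiveOn D U g) (hV : V ⊆ U) : IsPrimitiveOn D V g :=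
  fun _ _ γ hγ => h γ fun s => hV (hγ s)

theorem IsPrimitiveOn.congr (h : IsPrimitiveOn D U g) (h' : Set.EqOn g g' U) :
    IsPrimitiveOn D U g' := fun x y γ hγ => by
  rw [h γ hγ, h' (by simpa using hγ 0 : x ∈ U), h' (by simpa using hγ 1 : y ∈ U)]

theorem IsPrimitiveOn.sub_const (h : IsPrimitiveOn D U g) (m : M) :
    IsPrimitiveOn D U (fun x => g x - m) := fun x y γ hγ => by
  rw [h γ hγ, sub_sub_sub_cancel_right]

theorem IsPrimitiveOn.sub_eq_sub (h : IsPrimitiveOn D U g) (h' : IsPrimitiveOn D U g') {x y : X}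
    (hxy : JoinedIn U x y) : g y - g' y = g x - g' x := by
  have h1 := h hxy.somePath hxy.somePath_mem
  rw [h' hxy.somePath hxy.somePath_mem] at h1
  rw [sub_eq_sub_iff_add_eq_add] at h1 ⊢
  rw [← h1, add_comm]

theorem pathClass_segment_Icc {x y : X} (γ : Path x y) {a b : unitInterval} (hab : a ≤ b)
    (hU : ∀ s ∈ Set.Icc a b, γ s ∈ U) (h : IsPrimitiveOn D U g) :
    D (pathClass (segmentPath (extendMap γ) (a : ℝ) b)) = g (γ b) - g (γ a) := by
  rw [h, extendMap_apply, extendMap_apply]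
  intro s
  change extendMap γ (AffineMap.lineMap (a : ℝ) b (s : ℝ)) ∈ U
  have hm : AffineMap.lineMap (a : ℝ) b (s : ℝ) ∈ Set.Icc (a : ℝ) b := by
    have hab' : (a : ℝ) ≤ b := hab
    rw [← segment_eq_Icc hab', segment_eq_image_lineMap]
    exact ⟨s, s.2, rfl⟩
  rw [extendMap_apply γ ⟨_, a.2.1.trans hm.1, hm.2.trans b.2.2⟩]
  exact hU _ hm

/-- By compactness a path subdivides into finitely many pieces, each inside one U i, and the
increments of the common function g telescope. -/
theorem IsPrimitiveOn.iUnion {ι : Type*} {U : ι → Set X} (hU : ∀ i, IsOpen (U i))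
    (h : ∀ i, IsPrimitiveOn D (U i) g) : IsPrimitiveOn D (⋃ i, U i) g := by
  intro x y γ hγ
  obtain ⟨t, t0, tm, ⟨n, hn⟩, ht⟩ := exists_monotone_Icc_subset_open_cover_unitInterval
    (fun i => (hU i).preimage γ.continuous) (fun s _ => by simpa using hγ s)
  have key : ∀ k, D (pathClass (segmentPath (extendMap γ) (0 : ℝ) (t k))) = g (γ (t k)) - g x := by
    intro k
    induction k with
    | zero =>
      have : (t 0 : ℝ) = 0 := by rw [t0]; rfl
      rw [pathClass_eq_zero_of_const]
      · simp [t0]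
      · intro s
        change extendMap γ (AffineMap.lineMap (0 : ℝ) (t 0 : ℝ) (s : ℝ)) = _
        simp [this]
    | succ k ih =>
      obtain ⟨i, hi⟩ := ht k
      rw [← pathClass_segment_add _ (0 : ℝ) (t k) (t (k + 1)), map_add, ih,
        pathClass_segment_Icc γ (tm k.le_succ) hi (h i)]
      abel
  have := key n
  rw [hn n le_rfl] at this
  rw [← pathClass_extendMap γ]
  simpa using this

theorem IsPrimitiveOn.union (hU : IsOpen U) (hV : IsOpen V) (h : IsPrimitiveOn D U g)
    (h' : IsPrimitiveOn D V g) : IsPrimitiveOn D (U ∪ V) g := by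
  rw [Set.union_eq_iUnion]
  exact IsPrimitiveOn.iUnion (fun i => by cases i <;> assumption)
    (fun i => by cases i <;> assumption)

/-- A homeomorphic image of a star-shaped set carries primitives. -/
theorem exists_isPrimitiveOn_of_starConvex (D : ChainsModBoundaries X →ₗ[ℤ] M)
    {E : Type*} [AddCommGroup E] [Module ℝ E] [TopologicalSpace E]
    [ContinuousAdd E] [ContinuousSMul ℝ E] {S : Set E} (hS : StarConvex ℝ 0 S)
    {G : E → X} (hG : ContinuousOn G S) {q : X → E} (hq : ContinuousOn q U)
    (hqS : ∀ x ∈ U, q x ∈ S) (hGq : ∀ x ∈ U, G (q x) = x) : ∃ g, IsPrimitiveOn D U g := by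
  classical
  have hmem : ∀ e ∈ S, ∀ u : unitInterval, (u : ℝ) • e ∈ S := fun e he u =>
    starConvex_zero_iff.1 hS he u.2.1 u.2.2
  let rad : ∀ e ∈ S, Path (G ((0 : ℝ) • e)) (G ((1 : ℝ) • e)) := fun e he =>
    { toFun := fun u => G ((u : ℝ) • e)
      continuous_toFun := hG.comp_continuous (by fun_prop) (hmem e he)
      source' := rfl
      target' := rfl }
  -- The primitive integrates D along the radial path from the centre to x. The value 0 is never
  -- used on U, where q x lies in S.
  refine ⟨fun x => if h : q x ∈ S then D (pathClass (rad _ h)) else 0, fun x y γ hγ => ?_⟩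
  let pr : ℝ → unitInterval := Set.projIcc 0 1 zero_le_one
  have hpr : Continuous pr := continuous_projIcc
  have pr0 : pr 0 = 0 := Set.projIcc_left _
  have pr1 : pr 1 = 1 := Set.projIcc_right _
  have hprs : ∀ s : unitInterval, pr s = s := Set.projIcc_val _
  have hqγ : Continuous fun s => q (γ s) := hq.comp_continuous γ.continuous hγ
  -- The square swept out by the radii to the points of γ, clamped by `projIcc` so that it is
  -- defined on all of ℝ × ℝ. Its side over radius 0 is constant. The two triangles cut off by the
  -- diagonal show that the radius to x followed by γ has the class of the radius to y.
  let K : C(ℝ × ℝ, X) := ⟨fun a => G ((pr a.1 : ℝ) • q (γ (pr a.2))),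
    hG.comp_continuous
      ((continuous_subtype_val.comp (hpr.comp continuous_fst)).smul
        (hqγ.comp (hpr.comp continuous_snd)))
      (fun a => hmem _ (hqS _ (hγ _)) _)⟩
  have hx : q x ∈ S := by simpa using hqS _ (hγ 0)
  have hy : q y ∈ S := by simpa using hqS _ (hγ 1)
  have e1 := pathClass_segment_add K (0, 0) (1, 0) (1, 1)
  have e2 := pathClass_segment_add K (0, 0) (0, 1) (1, 1)
  have hK : ∀ a b, K (a, b) = G ((pr a : ℝ) • q (γ (pr b))) := fun _ _ => rfl
  have a1 : pathClass (segmentPath K (0, 0) (1, 0)) = pathClass (rad _ hx) := by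
    refine pathClass_congr fun s => ?_
    change K (AffineMap.lineMap ((0 : ℝ), (0 : ℝ)) (1, 0) (s : ℝ)) = G ((s : ℝ) • q x)
    simp [AffineMap.lineMap_apply_module, hK, pr0, hprs]
  have a2 : pathClass (segmentPath K (1, 0) (1, 1)) = pathClass γ := by
    refine pathClass_congr fun s => ?_
    change K (AffineMap.lineMap ((1 : ℝ), (0 : ℝ)) (1, 1) (s : ℝ)) = γ s
    simp [AffineMap.lineMap_apply_module, hK, pr1, hprs, hGq _ (hγ s)]
  have a3 : pathClass (segmentPath K (0, 1) (1, 1)) = pathClass (rad _ hy) := by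
    refine pathClass_congr fun s => ?_
    change K (AffineMap.lineMap ((0 : ℝ), (1 : ℝ)) (1, 1) (s : ℝ)) = G ((s : ℝ) • q y)
    simp [AffineMap.lineMap_apply_module, hK, pr1, hprs]
  have a4 : pathClass (segmentPath K (0, 0) (0, 1)) = 0 := by
    refine pathClass_eq_zero_of_const _ fun s => ?_
    change K (AffineMap.lineMap ((0 : ℝ), (0 : ℝ)) (0, 1) (s : ℝ)) = K (0, 0)
    simp [AffineMap.lineMap_apply_module, hK, pr0]
  rw [a1, a2, ← e2, a3, a4, zero_add] at e1
  dsimp only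
  rw [dif_pos hx, dif_pos hy, ← e1, map_add]
  abel

end Primitives

/-! ### Homomorphisms out of 1-chains modulo boundaries. -/

section Homs

variable {X : Type} [TopologicalSpace X] {M : Type} [AddCommGroup M]

open Simplicial in
theorem exists_eq_pathSimplex (s : (TopCat.toSSet.obj (TopCat.of X)) _⦋1⦌) :
    ∃ (x y : X) (γ : Path x y), pathSimplex γ = s := by
  let f : C(stdSimplex ℝ (Fin 2), X) := (TopCat.of X).toSSetObjEquiv (.op ⦋1⦌) s
  refine ⟨_, _, ⟨f.comp ⟨_, stdSimplexHomeomorphUnitInterval.symm.continuous⟩, rfl, rfl⟩, ?_⟩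
  rw [pathSimplex_eq]
  apply ((TopCat.of X).toSSetObjEquiv (.op ⦋1⦌)).injective
  refine ContinuousMap.ext fun z => ?_
  change f (stdSimplexHomeomorphUnitInterval.symm (stdSimplexHomeomorphUnitInterval z)) = f z
  rw [Homeomorph.symm_apply_apply]

theorem singularChains_hom_ext {N : ModuleCat.{0} ℤ} {f f' : (singularChains X).X 1 ⟶ N}
    (h : ∀ (x y : X) (γ : Path x y), pathChain γ ≫ f = pathChain γ ≫ f') : f = f' := by
  refine SSet.chainComplex_hom_ext fun s => ?_
  obtain ⟨x, y, γ, rfl⟩ := exists_eq_pathSimplex s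
  exact h x y γ

/-- The map `ℤ → C₀(X, ℤ)` given by a point. -/
def pointChain (x : X) : ModuleCat.of ℤ ℤ ⟶ (singularChains X).X 0 :=
  (TopCat.toSSet.obj (TopCat.of X)).ιChainComplex (TopCat.toSSetObj₀Equiv.symm x)

theorem pathChain_comp_d {x y : X} (γ : Path x y) :
    pathChain γ ≫ (singularChains X).d 1 0 = pointChain y - pointChain x := by
  have h := SSet.ιChainComplex_d (R := ModuleCat.of ℤ ℤ) (TopCat.toSSet.obj (TopCat.of X))
    (n := 0) (pathSimplex γ)
  refine h.trans ?_
  have h0 : (TopCat.toSSet.obj (TopCat.of X)).δ 0 (pathSimplex γ) =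
      (TopCat.toSSetObj₀Equiv (X := TopCat.of X)).symm y := by
    unfold pathSimplex
    rw [TopCat.δ_zero_toSSetObj₁Equiv.symm, TopCat.Path.hom₁]
  have h1 : (TopCat.toSSet.obj (TopCat.of X)).δ 1 (pathSimplex γ) =
      (TopCat.toSSetObj₀Equiv (X := TopCat.of X)).symm x := by
    unfold pathSimplex
    rw [TopCat.δ_one_toSSetObj₁Equiv.symm, TopCat.Path.hom₀]
  rw [Fin.sum_univ_two, h0, h1]
  simp [sub_eq_add_neg]
  rfl

theorem exists_pointChain_comp (g : X → M) :
    ∃ ψ : (singularChains X).X 0 ⟶ ModuleCat.of ℤ M, ∀ x,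
      (pointChain x ≫ ψ).hom (1 : ℤ) = g x := by
  refine ⟨Limits.Cofan.IsColimit.desc ((TopCat.toSSet.obj (TopCat.of X)).isColimitChainComplexXCofan
    (ModuleCat.of ℤ ℤ) 0) (fun s => ModuleCat.ofHom
      (LinearMap.toSpanSingleton ℤ M (g (TopCat.toSSetObj₀Equiv s)))), fun x => ?_⟩
  have := Limits.Cofan.IsColimit.fac
    ((TopCat.toSSet.obj (TopCat.of X)).isColimitChainComplexXCofan (ModuleCat.of ℤ ℤ) 0)
    (fun s => ModuleCat.ofHom (LinearMap.toSpanSingleton ℤ M (g (TopCat.toSSetObj₀Equiv s))))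
    (TopCat.toSSetObj₀Equiv.symm x)
  refine (congrArg (fun f => f.hom (1 : ℤ)) this).trans ?_
  simp

/-- A homomorphism with a global primitive vanishes on homology. -/
theorem IsPrimitiveOn.comp_homologyToChains {D : ChainsModBoundaries X →ₗ[ℤ] M} {g : X → M}
    (h : IsPrimitiveOn D Set.univ g) (a : H1 X) : D (homologyToChains X a) = 0 := by
  obtain ⟨ψ, hψ⟩ := exists_pointChain_comp g
  obtain ⟨D', hD'⟩ : ∃ D' : (singularChains X).opcycles 1 ⟶ ModuleCat.of ℤ M,
    ∀ b, D'.hom b = D b := ⟨ModuleCat.ofHom D, fun _ => rfl⟩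
  -- A global primitive says that D factors through the boundary map to 0-chains, which kills
  -- cycles.
  have e : (singularChains X).pOpcycles 1 ≫ D' = (singularChains X).d 1 0 ≫ ψ := by
    refine singularChains_hom_ext fun x y γ => ?_
    rw [← Category.assoc, ← Category.assoc, pathChain_comp_d, Preadditive.sub_comp]
    ext
    change D'.hom (pathClass γ) =
      (pointChain y ≫ ψ).hom (1 : ℤ) - (pointChain x ≫ ψ).hom (1 : ℤ)
    rw [hψ, hψ, hD', h γ fun _ => trivial]
  have e2 : (singularChains X).homologyι 1 ≫ D' = 0 := by
    rw [← cancel_epi ((singularChains X).homologyπ 1), ← Category.assoc,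
      HomologicalComplex.homology_π_ι, Category.assoc, e, ← Category.assoc,
      HomologicalComplex.iCycles_d, Limits.zero_comp, Limits.comp_zero]
  rw [← hD']
  exact congrArg (fun f => f.hom a) e2

/-- An additive function on paths descends to the `1`-chains modulo boundaries. -/
theorem exists_hom_of_triangle (c : C(unitInterval, X) → M)
    (hc : ∀ f : C(stdSimplex ℝ (Fin 3), X), c (triangleEdge f 1).toContinuousMap =
      c (triangleEdge f 2).toContinuousMap + c (triangleEdge f 0).toContinuousMap) :
    ∃ D : ChainsModBoundaries X →ₗ[ℤ] M, ∀ ⦃x y : X⦄ (γ : Path x y),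
      D (pathClass γ) = c γ.toContinuousMap := by
  let m : (TopCat.toSSet.obj (TopCat.of X)).obj (.op (SimplexCategory.mk 1)) → C(unitInterval, X) :=
    fun s => ((TopCat.of X).toSSetObjEquiv (.op (SimplexCategory.mk 1)) s).comp
      ⟨_, stdSimplexHomeomorphUnitInterval.symm.continuous⟩
  have hm : ∀ ⦃x y : X⦄ (γ : Path x y), m (pathSimplex γ) = γ.toContinuousMap := by
    intro x y γ
    refine ContinuousMap.ext fun z => ?_
    change γ (stdSimplexHomeomorphUnitInterval (stdSimplexHomeomorphUnitInterval.symm z)) = γ z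
    rw [Homeomorph.apply_symm_apply]
  let F : ∀ s : (TopCat.toSSet.obj (TopCat.of X)).obj (.op (SimplexCategory.mk 1)),
    ModuleCat.of ℤ ℤ ⟶ ModuleCat.of ℤ M := fun s =>
      ModuleCat.ofHom (LinearMap.toSpanSingleton ℤ M (c (m s)))
  let φ : (singularChains X).X 1 ⟶ ModuleCat.of ℤ M := Limits.Cofan.IsColimit.desc
    ((TopCat.toSSet.obj (TopCat.of X)).isColimitChainComplexXCofan (ModuleCat.of ℤ ℤ) 1) F
  have hφ : ∀ ⦃x y : X⦄ (γ : Path x y), pathChain γ ≫ φ =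
      ModuleCat.ofHom (LinearMap.toSpanSingleton ℤ M (c γ.toContinuousMap)) := by
    intro x y γ
    have := Limits.Cofan.IsColimit.fac
      ((TopCat.toSSet.obj (TopCat.of X)).isColimitChainComplexXCofan (ModuleCat.of ℤ ℤ) 1) F
      (pathSimplex γ)
    refine this.trans ?_
    simp only [F, hm]
  have hd : (singularChains X).d 2 1 ≫ φ = 0 := by
    refine SSet.chainComplex_hom_ext fun s => ?_
    obtain ⟨f, rfl⟩ : ∃ f, triangleSimplex f = s :=
      ((TopCat.of X).toSSetObjEquiv (.op (SimplexCategory.mk 2))).symm.surjective s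
    change triangleChain f ≫ (singularChains X).d 2 1 ≫ φ = triangleChain f ≫ 0
    rw [← Category.assoc, triangleChain_d, Limits.comp_zero, Preadditive.add_comp,
      Preadditive.sub_comp, hφ, hφ, hφ, hc]
    ext
    simp
  refine ⟨((singularChains X).descOpcycles φ 2 (by simp) hd).hom, fun x y γ => ?_⟩
  have : (pathChain γ ≫ (singularChains X).pOpcycles 1) ≫
      (singularChains X).descOpcycles φ 2 (by simp) hd = pathChain γ ≫ φ := by simp
  refine (congrArg (fun f => f.hom (1 : ℤ)) this).trans ?_
  rw [hφ]
  simp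

end Homs

/-! ### Winding of circle-valued maps. -/

section Winding

variable {A : Type} [TopologicalSpace A]

theorem exists_circle_lift [SimplyConnectedSpace A] [LocallyPathConnectedSpace A]
    (f : C(A, Circle)) : ∃ θ : C(A, ℝ), ∀ a, Circle.exp (θ a) = f a := by
  obtain ⟨a₀⟩ : Nonempty A := inferInstance
  obtain ⟨e₀, he⟩ := Circle.exp_surjective (f a₀)
  obtain ⟨θ, ⟨-, hθ⟩, -⟩ := Circle.isCoveringMap_exp.existsUnique_continuousMap_lifts f a₀ e₀ he
  exact ⟨θ, fun a => congrFun hθ a⟩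

theorem circle_lift_sub [PreconnectedSpace A] (θ θ' : C(A, ℝ))
    (h : ∀ a, Circle.exp (θ a) = Circle.exp (θ' a)) (a b : A) : θ b - θ a = θ' b - θ' a := by
  have := Circle.isCoveringMap_exp.eq_of_comp_eq (g₁ := θ)
    (g₂ := fun b => θ' b + (θ a - θ' a)) (by fun_prop) (by fun_prop)
    (by
      funext b
      change Circle.exp (θ b) = Circle.exp (θ' b + (θ a - θ' a))
      rw [Circle.exp_add, Circle.exp_sub, h a, div_self', mul_one, h b]) a (by ring)
  rw [congrFun this b]
  ring

variable {X : Type} [TopologicalSpace X]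

/-- The increment of a real lift of F along a path does not depend on the lift. It is additive on
triangles because F lifts over the whole simply connected triangle. -/
theorem exists_winding (F : C(X, Circle)) :
    ∃ w : ChainsModBoundaries X →ₗ[ℤ] ℝ, ∀ ⦃x y : X⦄ (γ : Path x y) (θ : C(unitInterval, ℝ)),
      (∀ s, Circle.exp (θ s) = F (γ s)) → w (pathClass γ) = θ 1 - θ 0 := by
  have : LocallyPathConnectedSpace unitInterval :=
    Convex.locallyPathConnectedSpace ℝ (convex_Icc (0 : ℝ) 1)
  have : LocallyPathConnectedSpace (stdSimplex ℝ (Fin 3)) :=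
    Convex.locallyPathConnectedSpace (Fin 3 → ℝ) (convex_stdSimplex ℝ (Fin 3))
  have : ContractibleSpace (stdSimplex ℝ (Fin 3)) :=
    (convex_stdSimplex ℝ (Fin 3)).contractibleSpace
      ⟨_, single_mem_stdSimplex ℝ (0 : Fin 3)⟩
  have : ContractibleSpace unitInterval :=
    (convex_Icc (0 : ℝ) 1).contractibleSpace ⟨0, by simp⟩
  choose l hl using fun p : C(unitInterval, X) => exists_circle_lift (F.comp p)
  have hl' : ∀ (p : C(unitInterval, X)) (θ : C(unitInterval, ℝ)),
      (∀ s, Circle.exp (θ s) = F (p s)) → l p 1 - l p 0 = θ 1 - θ 0 := fun p θ h =>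
    circle_lift_sub _ _ (fun s => (hl p s).trans (h s).symm) 0 1
  obtain ⟨w, hw⟩ := exists_hom_of_triangle (X := X) (M := ℝ) (fun p => l p 1 - l p 0) (by
    intro f
    obtain ⟨Θ, hΘ⟩ := exists_circle_lift (F.comp f)
    have key : ∀ i, l (triangleEdge f i).toContinuousMap 1 - l (triangleEdge f i).toContinuousMap 0
        = Θ (stdSimplex.vertex (i.succAbove 1)) - Θ (stdSimplex.vertex (i.succAbove 0)) := by
      intro i
      rw [hl' _ (Θ.comp ⟨fun s => stdSimplex.map i.succAbove
        (stdSimplexHomeomorphUnitInterval.symm s), (stdSimplex.continuous_map _).comp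
          stdSimplexHomeomorphUnitInterval.symm.continuous⟩) (fun s => hΘ _)]
      have h0 : stdSimplexHomeomorphUnitInterval.symm 0 = stdSimplex.vertex 0 :=
        stdSimplexHomeomorphUnitInterval.symm_apply_eq.2 rfl
      have h1 : stdSimplexHomeomorphUnitInterval.symm 1 = stdSimplex.vertex 1 :=
        stdSimplexHomeomorphUnitInterval.symm_apply_eq.2 rfl
      rw [← stdSimplex.map_vertex i.succAbove 1, ← stdSimplex.map_vertex i.succAbove 0, ← h0, ← h1]
      rfl
    rw [key, key, key]
    simp [Fin.succAbove, Fin.lt_def])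
  exact ⟨w, fun x y γ θ h => (hw γ).trans (hl' _ θ h)⟩

/-- The increment of the argument of `F` along paths. -/
def winding (F : C(X, Circle)) : ChainsModBoundaries X →ₗ[ℤ] ℝ := (exists_winding F).choose

theorem winding_pathClass (F : C(X, Circle)) {x y : X} (γ : Path x y) (θ : C(unitInterval, ℝ))
    (h : ∀ s, Circle.exp (θ s) = F (γ s)) : winding F (pathClass γ) = θ 1 - θ 0 :=
  (exists_winding F).choose_spec γ θ h

theorem exists_path_lift (F : C(X, Circle)) {x y : X} (γ : Path x y) :
    ∃ θ : C(unitInterval, ℝ), ∀ s, Circle.exp (θ s) = F (γ s) := by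
  have : LocallyPathConnectedSpace unitInterval :=
    Convex.locallyPathConnectedSpace ℝ (convex_Icc (0 : ℝ) 1)
  have : ContractibleSpace unitInterval :=
    (convex_Icc (0 : ℝ) 1).contractibleSpace ⟨0, by simp⟩
  exact exists_circle_lift (F.comp γ.toContinuousMap)

theorem exp_winding (F : C(X, Circle)) {x y : X} (γ : Path x y) :
    Circle.exp (winding F (pathClass γ)) = F y / F x := by
  obtain ⟨θ, hθ⟩ := exists_path_lift F γ
  rw [winding_pathClass F γ θ hθ, Circle.exp_sub, hθ, hθ, γ.source, γ.target]

theorem winding_of_inv (F : C(X, Circle)) {x y x' y' : X} (γ : Path x y) (γ' : Path x' y')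
    (h : ∀ s, F (γ' s) = (F (γ s))⁻¹) :
    winding F (pathClass γ') = -winding F (pathClass γ) := by
  obtain ⟨θ, hθ⟩ := exists_path_lift F γ
  rw [winding_pathClass F γ θ hθ, winding_pathClass F γ' (-θ)]
  · simp
    ring
  · intro s
    rw [h, ← hθ, ← Circle.exp_neg]
    rfl

/-- If `F` is inverted by reversal of the path, then the half of its winding is that of the second
half of the path. -/
theorem exp_half_winding (F : C(X, Circle)) {x y : X} (γ : Path x y)
    (h : ∀ s, F (γ (unitInterval.symm s)) = (F (γ s))⁻¹) (m : unitInterval)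
    (hm : unitInterval.symm m = m) :
    Circle.exp (winding F (pathClass γ) / 2) = F y / F (γ m) := by
  obtain ⟨θ, hθ⟩ := exists_path_lift F γ
  -- Both θ and minus its reversal lift the same map, so their increments from m to 1 agree. As m is
  -- fixed by reversal, the two halves of the path contribute equally.
  have h2 := circle_lift_sub (A := unitInterval) θ
    (-(θ.comp ⟨_, unitInterval.continuous_symm⟩)) (fun s => by
      change _ = Circle.exp (-θ (unitInterval.symm s))
      rw [Circle.exp_neg, hθ, hθ, h, inv_inv]) m 1
  have h3 : θ 1 - θ m = -θ 0 - -θ m := by simpa [hm] using h2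
  have h4 : winding F (pathClass γ) / 2 = θ 1 - θ m := by
    rw [winding_pathClass F γ θ hθ]
    linarith
  rw [h4, Circle.exp_sub, hθ, hθ, γ.target]

end Winding

/-! ### The two charts of the total space and the curve in them. -/

section Charts

theorem chartZ_eq_chartW {a b : ℂ × ℂ} :
    chartZ a = chartW b ↔ a.1 * b.1 = 1 ∧ b.2 = b.1 * a.2 :=
  Quotient.eq (r := TotSetoid)

theorem chartZ_injective : Function.Injective chartZ :=
  fun _ _ h => (Quotient.eq (r := TotSetoid)).1 h

theorem chartW_injective : Function.Injective chartW :=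
  fun _ _ h => (Quotient.eq (r := TotSetoid)).1 h

theorem isOpen_totL {s : Set TotL} :
    IsOpen s ↔ IsOpen (chartZ ⁻¹' s) ∧ IsOpen (chartW ⁻¹' s) := by
  have h : IsOpen s ↔ IsOpen (Quotient.mk TotSetoid ⁻¹' s) := Iff.rfl
  rw [h, isOpen_sum_iff]
  rfl

theorem continuous_chartZ : Continuous chartZ :=
  ⟨fun _ hs => (isOpen_totL.1 hs).1⟩

theorem continuous_chartW : Continuous chartW :=
  ⟨fun _ hs => (isOpen_totL.1 hs).2⟩

/-- The change of coordinates between the two charts, which is an involution. -/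
def transition (a : ℂ × ℂ) : ℂ × ℂ := (a.1⁻¹, a.1⁻¹ * a.2)

theorem isOpen_transition {s : Set (ℂ × ℂ)} (hs : IsOpen s) :
    IsOpen ({a : ℂ × ℂ | a.1 ≠ 0} ∩ transition ⁻¹' s) := by
  refine ContinuousOn.isOpen_inter_preimage ?_ (isOpen_ne_fun continuous_fst continuous_const) hs
  have h : ContinuousOn (fun a : ℂ × ℂ => a.1⁻¹) {a : ℂ × ℂ | a.1 ≠ 0} :=
    continuousOn_fst.inv₀ fun _ ha => ha
  exact h.prodMk (h.mul continuousOn_snd)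

theorem chartW_transition {a : ℂ × ℂ} (ha : a.1 ≠ 0) : chartW (transition a) = chartZ a :=
  (chartZ_eq_chartW.2 ⟨mul_inv_cancel₀ ha, rfl⟩).symm

theorem chartZ_transition {b : ℂ × ℂ} (hb : b.1 ≠ 0) : chartZ (transition b) = chartW b := by
  refine chartZ_eq_chartW.2 ⟨inv_mul_cancel₀ hb, ?_⟩
  simp only [transition]
  field_simp

theorem isOpenEmbedding_chartZ : Topology.IsOpenEmbedding chartZ := by
  refine .of_continuous_injective_isOpenMap continuous_chartZ chartZ_injective fun s hs => ?_
  rw [isOpen_totL, Set.preimage_image_eq _ chartZ_injective]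
  refine ⟨hs, ?_⟩
  convert! isOpen_transition hs using 1
  ext b
  constructor
  · rintro ⟨a, ha, hab⟩
    have h := chartZ_eq_chartW.1 hab
    have hb : b.1 ≠ 0 := fun h0 => by simp [h0] at h
    refine ⟨hb, ?_⟩
    rw [← chartZ_transition hb] at hab
    rwa [Set.mem_preimage, ← chartZ_injective hab]
  · rintro ⟨hb, hs⟩
    exact ⟨_, hs, chartZ_transition hb⟩

theorem isOpenEmbedding_chartW : Topology.IsOpenEmbedding chartW := by
  refine .of_continuous_injective_isOpenMap continuous_chartW chartW_injective fun s hs => ?_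
  rw [isOpen_totL, Set.preimage_image_eq _ chartW_injective]
  refine ⟨?_, hs⟩
  convert! isOpen_transition hs using 1
  ext a
  constructor
  · rintro ⟨b, hb, hab⟩
    have h := chartZ_eq_chartW.1 hab.symm
    have ha : a.1 ≠ 0 := fun h0 => by simp [h0] at h
    refine ⟨ha, ?_⟩
    rw [← chartW_transition ha] at hab
    rwa [Set.mem_preimage, ← chartW_injective hab]
  · rintro ⟨ha, hs⟩
    exact ⟨_, hs, chartW_transition ha⟩

theorem chartZ_mem_compactCurve {t : ℂ} {a : ℂ × ℂ} :
    chartZ a ∈ compactCurve t ↔ a.2 ^ 3 = t * (a.1 * (1 - a.1)) := by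
  constructor
  · rintro (⟨a', h, e⟩ | ⟨b, h, e⟩)
    · obtain rfl := chartZ_injective e
      simp only [affineCurve, Set.mem_ofPred_eq] at h
      linear_combination h
    · obtain ⟨h1, h2⟩ := chartZ_eq_chartW.1 e.symm
      simp only [Set.mem_ofPred_eq, h2] at h
      have h3 : b.1 ≠ 0 := right_ne_zero_of_mul_eq_one h1
      have h4 : a.1 = b.1⁻¹ := eq_inv_of_mul_eq_one_left h1
      rw [h4]
      field_simp
      apply mul_left_cancel₀ h3
      linear_combination h
  · intro h
    refine Or.inl ⟨a, ?_, rfl⟩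
    simp only [affineCurve, Set.mem_ofPred_eq]
    linear_combination h

theorem chartW_mem_compactCurve {t : ℂ} {b : ℂ × ℂ} :
    chartW b ∈ compactCurve t ↔ b.2 ^ 3 = -t * (b.1 * (1 - b.1)) := by
  constructor
  · rintro (⟨a, h, e⟩ | ⟨b', h, e⟩)
    · obtain ⟨h1, h2⟩ := chartZ_eq_chartW.1 e
      simp only [affineCurve, Set.mem_ofPred_eq] at h
      have h3 : b.1 ≠ 0 := right_ne_zero_of_mul_eq_one h1
      have h4 : a.1 = b.1⁻¹ := eq_inv_of_mul_eq_one_left h1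
      rw [h2]
      rw [h4] at h
      field_simp at h
      linear_combination b.1 * h
    · obtain rfl := chartW_injective e
      simp only [Set.mem_ofPred_eq] at h
      linear_combination h
  · intro h
    refine Or.inr ⟨b, ?_, rfl⟩
    simp only [Set.mem_ofPred_eq]
    linear_combination h

/-- At w = 0 the equation reduces to η³ = 0, so the curve has a single point at infinity. -/
theorem exists_chart_of_mem_compactCurve {t : ℂ} {x : TotL} (hx : x ∈ compactCurve t) :
    (∃ a, chartZ a = x) ∨ x = chartW (0, 0) := by
  rcases hx with ⟨a, -, rfl⟩ | ⟨⟨w, η⟩, h, rfl⟩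
  · exact Or.inl ⟨a, rfl⟩
  · by_cases hw : w = 0
    · subst hw
      simp at h
      rw [h]
      exact Or.inr rfl
    · exact Or.inl ⟨_, chartZ_transition hw⟩

end Charts

/-! ### Cube roots. -/

section CubeRoots

/-- The principal branch of the cube root. -/
def cbrt (z : ℂ) : ℂ := z ^ ((3 : ℕ) : ℂ)⁻¹

theorem cbrt_pow (z : ℂ) : cbrt z ^ 3 = z := Complex.cpow_nat_inv_pow z three_ne_zero

theorem cbrt_ne_zero {z : ℂ} (hz : z ≠ 0) : cbrt z ≠ 0 := fun h => hz (by
  rw [← cbrt_pow z, h]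
  simp)

theorem continuousOn_cbrt : ContinuousOn cbrt Complex.slitPlane :=
  fun _ hz => (continuousAt_cpow_const hz).continuousWithinAt

theorem ε_isPrimitiveRoot : IsPrimitiveRoot ε 3 := by
  have := Complex.isPrimitiveRoot_exp 3 three_ne_zero
  unfold ε
  exact_mod_cast this

theorem ε_pow_three : ε ^ 3 = 1 := ε_isPrimitiveRoot.pow_eq_one

theorem exists_eq_ε_pow {u : ℂ} (h : u ^ 3 = 1) : ∃ j : Fin 3, u = ε ^ (j : ℕ) := by
  obtain ⟨i, hi, h⟩ := ε_isPrimitiveRoot.eq_pow_of_pow_eq_one h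
  exact ⟨⟨i, hi⟩, h.symm⟩

end CubeRoots

/-! ### Primitives on the curve. -/

section Generation

variable {t : ℂ} {M : Type} [AddCommGroup M]

/-- Near the branch point at coordinate 0 the curve is uniformised by s with s³ equal to the base
coordinate, since 1 minus that coordinate has a principal cube root. A general chart E allows one
proof for the branch points over 0, 1 and ∞. -/
theorem exists_isPrimitiveOn_disc (D : ChainsModBoundaries (compactCurve t) →ₗ[ℤ] M)
    {E : ℂ × ℂ → TotL} (hE : Topology.IsOpenEmbedding E) {c : ℂ} (hc : c ≠ 0)
    (hX : ∀ a, E a ∈ compactCurve t ↔ a.2 ^ 3 = c * (a.1 * (1 - a.1))) :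
    ∃ g, IsPrimitiveOn D (Subtype.val ⁻¹' (E '' {a | 1 - a.1 ∈ Complex.slitPlane})) g := by
  have hl : cbrt c ≠ 0 := cbrt_ne_zero hc
  have hinv : ∀ a, Function.invFun E (E a) = a := Function.leftInverse_invFun hE.injective
  have hmem : ∀ s : ℂ, E (s ^ 3, cbrt c * s * cbrt (1 - s ^ 3)) ∈ compactCurve t := fun s => by
    rw [hX]
    simp only [mul_pow, cbrt_pow]
    ring
  refine exists_isPrimitiveOn_of_starConvex D (S := {s : ℂ | 1 - s ^ 3 ∈ Complex.slitPlane})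
    (G := fun s => ⟨_, hmem s⟩)
    (q := fun x => (Function.invFun E x.1).2 / (cbrt c * cbrt (1 - (Function.invFun E x.1).1)))
    ?_ ?_ ?_ ?_ ?_
  · refine starConvex_zero_iff.2 fun s hs u hu0 hu1 => ?_
    -- The point 1 - (us)³ is the convex combination of 1 and 1 - s³ with weights 1 - u³ and u³, and
    -- the slit plane is star-shaped about 1.
    have h := Complex.starConvex_one_slitPlane hs (sub_nonneg.2 (pow_le_one₀ (n := 3) hu0 hu1))
      (pow_nonneg hu0 3) (by ring)
    simp only [Set.mem_ofPred_eq, Complex.real_smul] at h ⊢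
    convert! h using 1
    push_cast
    ring
  · refine Topology.IsInducing.subtypeVal.continuousOn_iff.2 ?_
    refine hE.continuous.comp_continuousOn
      (f := fun s : ℂ => (s ^ 3, cbrt c * s * cbrt (1 - s ^ 3))) ?_
    refine ContinuousOn.prodMk (by fun_prop) (ContinuousOn.mul (by fun_prop) ?_)
    exact continuousOn_cbrt.comp (by fun_prop) fun s hs => hs
  · have h1 : ContinuousOn (fun a : ℂ × ℂ => a.2 / (cbrt c * cbrt (1 - a.1)))
        {a | 1 - a.1 ∈ Complex.slitPlane} := by
      refine ContinuousOn.div (by fun_prop) (ContinuousOn.mul (by fun_prop) ?_) fun a ha =>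
        mul_ne_zero hl (cbrt_ne_zero (Complex.slitPlane_ne_zero ha))
      exact continuousOn_cbrt.comp (by fun_prop) fun s hs => hs
    have h2 : ContinuousOn (Function.invFun E) (Set.range E) := by
      rintro _ ⟨a, rfl⟩
      refine ContinuousAt.continuousWithinAt ?_
      rw [← hE.continuousAt_iff]
      exact continuousAt_id.congr (Filter.Eventually.of_forall fun a => (hinv a).symm)
    refine h1.comp (h2.comp continuous_subtype_val.continuousOn ?_) ?_
    · rintro x ⟨a, -, ha⟩
      exact ⟨a, ha⟩
    · rintro x ⟨a, h, ha⟩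
      change Function.invFun E x.1 ∈ _
      rw [← ha, hinv]
      exact h
  · rintro ⟨x, hx⟩ ⟨a, h, rfl⟩
    have h0 := Complex.slitPlane_ne_zero h
    rw [hX] at hx
    simp only [Set.mem_ofPred_eq, hinv, div_pow, mul_pow, cbrt_pow, hx]
    rw [Set.mem_ofPred_eq] at h
    convert! h using 2
    field_simp
  · rintro ⟨x, hx⟩ ⟨a, h, rfl⟩
    have h0 := Complex.slitPlane_ne_zero h
    have h1 := cbrt_ne_zero h0
    rw [hX] at hx
    apply Subtype.ext
    simp only [hinv]
    have h2 : (a.2 / (cbrt c * cbrt (1 - a.1))) ^ 3 = a.1 := by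
      simp only [div_pow, mul_pow, cbrt_pow, hx]
      field_simp
    rw [h2]
    congr 1
    refine Prod.ext rfl ?_
    simp only
    field_simp

/-- The chart of `Tot L` obtained from `(z, ζ)` by the reflection `z ↦ 1 - z`. -/
def chartR (a : ℂ × ℂ) : TotL := chartZ (1 - a.1, a.2)

theorem isOpenEmbedding_chartR : Topology.IsOpenEmbedding chartR :=
  isOpenEmbedding_chartZ.comp
    ((Homeomorph.subLeft (1 : ℂ)).prodCongr (Homeomorph.refl ℂ)).isOpenEmbedding

theorem chartR_mem_compactCurve {a : ℂ × ℂ} :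
    chartR a ∈ compactCurve t ↔ a.2 ^ 3 = t * (a.1 * (1 - a.1)) := by
  rw [chartR, chartZ_mem_compactCurve]
  simp only
  ring_nf

/-- The part of the compactified curve over `z ∉ [1, ∞)`. -/
def discZero (t : ℂ) : Set (compactCurve t) :=
  Subtype.val ⁻¹' (chartZ '' {a | 1 - a.1 ∈ Complex.slitPlane})

/-- The part of the compactified curve over `z ∉ (-∞, 0]`. -/
def discOne (t : ℂ) : Set (compactCurve t) :=
  Subtype.val ⁻¹' (chartR '' {a | 1 - a.1 ∈ Complex.slitPlane})

/-- The part of the compactified curve over `|w| < 1`. -/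
def discInfinity (t : ℂ) : Set (compactCurve t) :=
  Subtype.val ⁻¹' (chartW '' {b | ‖b.1‖ < 1})

theorem isOpen_slit : IsOpen {a : ℂ × ℂ | 1 - a.1 ∈ Complex.slitPlane} :=
  Complex.isOpen_slitPlane.preimage (by fun_prop : Continuous fun a : ℂ × ℂ => 1 - a.1)

theorem isOpen_discZero : IsOpen (discZero t) :=
  (isOpenEmbedding_chartZ.isOpenMap _ isOpen_slit).preimage continuous_subtype_val

theorem isOpen_discOne : IsOpen (discOne t) :=
  (isOpenEmbedding_chartR.isOpenMap _ isOpen_slit).preimage continuous_subtype_val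

theorem isOpen_discInfinity : IsOpen (discInfinity t) :=
  (isOpenEmbedding_chartW.isOpenMap _ (isOpen_lt (by fun_prop) continuous_const)).preimage
    continuous_subtype_val

theorem mem_discZero {x : compactCurve t} {a : ℂ × ℂ} (h : chartZ a = x) :
    x ∈ discZero t ↔ 1 - a.1 ∈ Complex.slitPlane := by
  rw [discZero, Set.mem_preimage, ← h, isOpenEmbedding_chartZ.injective.mem_set_image]
  rfl

theorem mem_discOne {x : compactCurve t} {a : ℂ × ℂ} (h : chartZ a = x) :
    x ∈ discOne t ↔ a.1 ∈ Complex.slitPlane := by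
  have h' : chartR (1 - a.1, a.2) = x := by simp [chartR, h]
  rw [discOne, Set.mem_preimage, ← h', isOpenEmbedding_chartR.injective.mem_set_image]
  simp

theorem one_sub_mem_slitPlane {z : ℂ} (h : ‖z‖ < 1) : 1 - z ∈ Complex.slitPlane := by
  refine Complex.mem_slitPlane_iff.2 (Or.inl ?_)
  have := (abs_le.1 (Complex.abs_re_le_norm z)).2
  simp
  linarith

theorem chartZ_mem_union {x : compactCurve t} {a : ℂ × ℂ} (h : chartZ a = x) :
    x ∈ discZero t ∪ discOne t := by
  rw [Set.mem_union, mem_discZero h, mem_discOne h, Complex.mem_slitPlane_iff,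
    Complex.mem_slitPlane_iff]
  by_cases h0 : 0 < a.1.re
  · exact Or.inr (Or.inl h0)
  · left; left
    simp
    linarith

theorem union_discs : discZero t ∪ discOne t ∪ discInfinity t = Set.univ := by
  refine Set.eq_univ_of_forall fun x => ?_
  rcases exists_chart_of_mem_compactCurve x.2 with ⟨a, h⟩ | h
  · exact Or.inl (chartZ_mem_union h)
  · exact Or.inr ⟨_, by simp, h.symm⟩

/-- The sheets over the doubly slit plane. -/
theorem joinedIn_sheet {μ : ℂ} (hμ : μ ^ 3 = t) {x y : compactCurve t} {a b : ℂ × ℂ}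
    (hx : chartZ a = x) (hy : chartZ b = y)
    (hxU : x ∈ discZero t ∩ discOne t) (hyU : y ∈ discZero t ∩ discOne t)
    (hax : a.2 = μ * cbrt a.1 * cbrt (1 - a.1)) (hby : b.2 = μ * cbrt b.1 * cbrt (1 - b.1)) :
    JoinedIn (discZero t ∩ discOne t) x y := by
  let Ω : Set ℂ := {z | z ∈ Complex.slitPlane ∧ 1 - z ∈ Complex.slitPlane}
  have hmid : (1 / 2 : ℂ) ∈ Ω := by
    constructor <;> rw [Complex.mem_slitPlane_iff] <;> norm_num
  have hΩ : StarConvex ℝ (1 / 2 : ℂ) Ω := by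
    rw [starConvex_iff_forall_pos hmid]
    rintro z ⟨h1, h2⟩ u v hu hv huv
    simp only [Ω, Set.mem_ofPred_eq, Complex.mem_slitPlane_iff, Complex.real_smul] at h1 h2 ⊢
    simp at h1 h2 ⊢
    constructor
    · rcases h1 with h | h
      · left; positivity
      · exact Or.inr ⟨hv.ne', h⟩
    · rcases h2 with h | h
      · left; nlinarith
      · exact Or.inr ⟨hv.ne', h⟩
  have hpc : IsPathConnected Ω := hΩ.isPathConnected hmid
  have hmem : ∀ z, chartZ (z, μ * cbrt z * cbrt (1 - z)) ∈ compactCurve t := fun z => by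
    rw [chartZ_mem_compactCurve]
    simp only [mul_pow, cbrt_pow, hμ]
    ring
  let N : ℂ → compactCurve t := fun z => ⟨_, hmem z⟩
  have hN : ContinuousOn N Ω := by
    refine Topology.IsInducing.subtypeVal.continuousOn_iff.2 ?_
    refine continuous_chartZ.comp_continuousOn
      (f := fun z : ℂ => (z, μ * cbrt z * cbrt (1 - z))) ?_
    refine continuousOn_id.prodMk (ContinuousOn.mul (ContinuousOn.mul (by fun_prop) ?_) ?_)
    · exact continuousOn_cbrt.mono fun z hz => hz.1
    · exact continuousOn_cbrt.comp (by fun_prop) fun s hs => hs.2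
  have hN' : N '' Ω ⊆ discZero t ∩ discOne t := by
    rintro _ ⟨z, hz, rfl⟩
    exact ⟨(mem_discZero rfl).2 hz.2, (mem_discOne rfl).2 hz.1⟩
  have hx' : x ∈ N '' Ω := ⟨a.1, ⟨(mem_discOne hx).1 hxU.2, (mem_discZero hx).1 hxU.1⟩,
    Subtype.ext (by rw [← hx, ← Prod.mk.eta (p := a), hax])⟩
  have hy' : y ∈ N '' Ω := ⟨b.1, ⟨(mem_discOne hy).1 hyU.2, (mem_discZero hy).1 hyU.1⟩,
    Subtype.ext (by rw [← hy, ← Prod.mk.eta (p := b), hby])⟩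
  exact ((hpc.image' hN).joinedIn _ hx' _ hy').mono hN'

/-- The cube root s of w is a coordinate here, with 0 < |s| < 1. Writing s = exp u makes the set a
continuous image of the half-plane Re u < 0. -/
theorem isPathConnected_puncturedDisc (ht : t ≠ 0) :
    IsPathConnected (discInfinity t ∩ (discZero t ∪ discOne t)) := by
  have hl : cbrt (-t) ≠ 0 := cbrt_ne_zero (neg_ne_zero.2 ht)
  have hmem : ∀ s : ℂ, chartW (s ^ 3, cbrt (-t) * s * cbrt (1 - s ^ 3)) ∈ compactCurve t :=
    fun s => by
      rw [chartW_mem_compactCurve]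
      simp only [mul_pow, cbrt_pow]
      ring
  let N : ℂ → compactCurve t := fun u => ⟨_, hmem (Complex.exp u)⟩
  have hnorm : ∀ u : ℂ, u.re < 0 → ‖Complex.exp u ^ 3‖ < 1 := fun u hu => by
    rw [norm_pow, Complex.norm_exp]
    exact pow_lt_one₀ (Real.exp_pos _).le (Real.exp_lt_one_iff.2 hu) three_ne_zero
  have hN : ContinuousOn N {u | u.re < 0} := by
    refine Topology.IsInducing.subtypeVal.continuousOn_iff.2 ?_
    refine continuous_chartW.comp_continuousOn (f := fun u : ℂ =>
      (Complex.exp u ^ 3, cbrt (-t) * Complex.exp u * cbrt (1 - Complex.exp u ^ 3))) ?_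
    refine ContinuousOn.prodMk (by fun_prop) (ContinuousOn.mul (by fun_prop) ?_)
    exact continuousOn_cbrt.comp (by fun_prop) fun s hs => one_sub_mem_slitPlane (hnorm s hs)
  have hpc : IsPathConnected {u : ℂ | u.re < 0} :=
    (convex_halfSpace_re_lt 0).isPathConnected ⟨-1, by simp⟩
  convert! hpc.image' hN
  ext x
  constructor
  · rintro ⟨⟨b, hb, hbx⟩, hx⟩
    have hb0 : b.1 ≠ 0 := by
      have : ∃ a, chartZ a = x := by
        rcases hx with ⟨a, -, h⟩ | ⟨a, -, h⟩
        exacts [⟨a, h⟩, ⟨_, h⟩]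
      obtain ⟨a, ha⟩ := this
      exact right_ne_zero_of_mul_eq_one (chartZ_eq_chartW.1 (ha.trans hbx.symm)).1
    have hx2 := x.2
    rw [← hbx, chartW_mem_compactCurve] at hx2
    have h1 : 1 - b.1 ≠ 0 := Complex.slitPlane_ne_zero (one_sub_mem_slitPlane hb)
    have h2 := cbrt_ne_zero h1
    set s := b.2 / (cbrt (-t) * cbrt (1 - b.1)) with hs
    have hs3 : s ^ 3 = b.1 := by
      rw [hs]
      simp only [div_pow, mul_pow, cbrt_pow, hx2]
      field_simp
    have hs0 : s ≠ 0 := fun h => hb0 (by rw [← hs3, h]; simp)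
    refine ⟨Complex.log s, ?_, Subtype.ext ?_⟩
    · rw [Set.mem_ofPred_eq, Complex.log_re]
      refine Real.log_neg (norm_pos_iff.2 hs0) ?_
      by_contra! h
      have := one_le_pow₀ h (n := 3)
      rw [← norm_pow, hs3] at this
      exact absurd hb (not_lt.2 this)
    · simp only [N, Complex.exp_log hs0, hs3, ← hbx]
      congr 1
      refine Prod.ext rfl ?_
      simp only [hs]
      field_simp
  · rintro ⟨u, hu, rfl⟩
    refine ⟨⟨_, hnorm u hu, rfl⟩, ?_⟩
    exact chartZ_mem_union (chartZ_transition (by simp))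

/-- A homomorphism on `1`-chains which does not distinguish the sheets over the doubly slit plane
has a primitive. -/
theorem exists_isPrimitiveOn_univ (ht : t ≠ 0)
    (D : ChainsModBoundaries (compactCurve t) →ₗ[ℤ] M)
    (h : ∀ g g', IsPrimitiveOn D (discZero t) g → IsPrimitiveOn D (discOne t) g' →
      ∃ m, ∀ x ∈ discZero t ∩ discOne t, g' x - g x = m) :
    ∃ g, IsPrimitiveOn D Set.univ g := by
  classical
  obtain ⟨g₀, h₀⟩ := exists_isPrimitiveOn_disc D isOpenEmbedding_chartZ ht
    (fun a => chartZ_mem_compactCurve)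
  obtain ⟨g₁, h₁⟩ := exists_isPrimitiveOn_disc D isOpenEmbedding_chartR ht
    (fun a => chartR_mem_compactCurve)
  obtain ⟨g₂, h₂⟩ := exists_isPrimitiveOn_disc D isOpenEmbedding_chartW (neg_ne_zero.2 ht)
    (fun a => chartW_mem_compactCurve)
  change IsPrimitiveOn D (discZero t) g₀ at h₀
  change IsPrimitiveOn D (discOne t) g₁ at h₁
  replace h₂ : IsPrimitiveOn D (discInfinity t) g₂ := h₂.mono
    (Set.preimage_mono (Set.image_mono fun b hb => one_sub_mem_slitPlane hb))
  obtain ⟨m, hm⟩ := h g₀ g₁ h₀ h₁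
  let g : compactCurve t → M := fun x => if x ∈ discZero t then g₀ x else g₁ x - m
  have hg : IsPrimitiveOn D (discZero t ∪ discOne t) g := by
    refine IsPrimitiveOn.union isOpen_discZero isOpen_discOne (h₀.congr fun x hx => ?_)
      ((h₁.sub_const m).congr fun x hx => ?_)
    · simp [g, hx]
    · by_cases hx' : x ∈ discZero t
      · simp [g, hx', ← hm x ⟨hx', hx⟩]
      · simp [g, hx']
  obtain ⟨x₀, hx₀, hj⟩ := isPathConnected_puncturedDisc ht
  -- The primitive at infinity is shifted to agree with g at x₀. The overlap is path connected, so
  -- they agree on all of it.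
  let g' : compactCurve t → M := fun x =>
    if x ∈ discZero t ∪ discOne t then g x else g₂ x - (g₂ x₀ - g x₀)
  refine ⟨g', ?_⟩
  rw [← union_discs]
  refine IsPrimitiveOn.union (isOpen_discZero.union isOpen_discOne) isOpen_discInfinity
    (hg.congr fun x hx => ?_) ((h₂.sub_const (g₂ x₀ - g x₀)).congr fun x hx => ?_)
  · simp only [g', if_pos hx]
  · by_cases hx' : x ∈ discZero t ∪ discOne t
    · have := (h₂.mono Set.inter_subset_left).sub_eq_sub (hg.mono Set.inter_subset_right)
        (hj ⟨hx, hx'⟩)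
      simp only [g', if_pos hx', ← this]
      abel
    · simp only [g', if_neg hx']

end Generation

/-! ### The cycles A and B generate. -/

section Cycles

variable {t : ℂ} {r : ℝ}

theorem affineCurve_iff {a : ℂ × ℂ} : a ∈ affineCurve t ↔ a.2 ^ 3 = t * (a.1 * (1 - a.1)) := by
  rw [← chartZ_mem_compactCurve]
  constructor
  · exact fun h => Or.inl ⟨a, h, rfl⟩
  · intro h
    rw [chartZ_mem_compactCurve] at h
    simp only [affineCurve, Set.mem_ofPred_eq]
    linear_combination h

namespace SheetLifts

variable (D : SheetLifts t r)

/-- The image in the compactification of a path on the spectral curve. -/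
abbrev compactPath {x y : affineCurve t} (γ : Path x y) :
    Path (toCompact t x) (toCompact t y) := γ.map (toCompact t).continuous

theorem q_fst (j : Fin 3) : (D.q j).1.1 = 1 - r := by
  have := D.f_lift j 0
  simpa using this

theorem q_snd (j : Fin 3) : (D.q j).1.2 = ε ^ (j : ℕ) * (D.q 0).1.2 := by
  have := D.f_sheet j 0
  simpa using this

theorem pathClass_compactPath_symm {x y : affineCurve t} (γ : Path x y) :
    pathClass (compactPath γ.symm) = -pathClass (compactPath γ) :=
  (pathClass_congr fun _ => rfl).trans (pathClass_symm (compactPath γ))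

theorem pathClass_compactPath_trans {x y z : affineCurve t} (γ : Path x y) (γ' : Path y z) :
    pathClass (compactPath (γ.trans γ')) = pathClass (compactPath γ) + pathClass (compactPath γ') := by
  rw [compactPath, Path.map_trans, pathClass_trans]

theorem pathClass_loopA : pathClass (compactPath D.loopA) =
    pathClass (compactPath (D.f 0)) + pathClass (compactPath D.γ0) -
      pathClass (compactPath (D.f 1)) - pathClass (compactPath D.γ1) := by
  simp only [loopA, pathClass_compactPath_trans, pathClass_compactPath_symm]
  abel

theorem pathClass_loopB : pathClass (compactPath D.loopB) =
    pathClass (compactPath (D.f 1)) + pathClass (compactPath D.γ0') -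
      pathClass (compactPath (D.f 2)) - pathClass (compactPath D.γ1') := by
  simp only [loopB, pathClass_compactPath_trans, pathClass_compactPath_symm]
  abel

theorem toCompact_mem_discZero {a : affineCurve t} :
    toCompact t a ∈ discZero t ↔ 1 - a.1.1 ∈ Complex.slitPlane := mem_discZero rfl

theorem toCompact_mem_discOne {a : affineCurve t} :
    toCompact t a ∈ discOne t ↔ a.1.1 ∈ Complex.slitPlane := mem_discOne rfl

theorem segment_mem (hr : 0 < r) (hr' : r < 1 / 2) (j : Fin 3) (s : unitInterval) :
    compactPath (D.f j) s ∈ discZero t ∩ discOne t := by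
  change toCompact t (D.f j s) ∈ _
  have h : (D.f j s).1.1 = (((1 - (s : ℝ)) * (1 - r) + (s : ℝ) * r : ℝ) : ℂ) := by
    rw [D.f_lift]
    push_cast
    ring
  rw [Set.mem_inter_iff, toCompact_mem_discZero, toCompact_mem_discOne, h,
    ← Complex.ofReal_one, ← Complex.ofReal_sub, Complex.ofReal_mem_slitPlane,
    Complex.ofReal_mem_slitPlane]
  constructor <;> nlinarith [s.2.1, s.2.2]

theorem circle_norm_lt (hr : 0 < r) (hr' : r < 1 / 2) (s : ℝ) :
    ‖(r : ℂ) * Complex.exp (2 * Real.pi * Complex.I * s)‖ < 1 := by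
  have : (2 * Real.pi * Complex.I * s : ℂ) = ((2 * Real.pi * s : ℝ) : ℂ) * Complex.I := by
    push_cast
    ring
  rw [norm_mul, this, Complex.norm_exp_ofReal_mul_I, mul_one, Complex.norm_real,
    Real.norm_of_nonneg hr.le]
  linarith

theorem circle_zero_mem (hr : 0 < r) (hr' : r < 1 / 2) {x y : affineCurve t} (γ : Path x y)
    (h : ∀ s, (γ s).1.1 = r * Complex.exp (2 * Real.pi * Complex.I * (s : ℝ)))
    (s : unitInterval) : compactPath γ s ∈ discZero t := by
  change toCompact t (γ s) ∈ _
  rw [toCompact_mem_discZero, h]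
  exact one_sub_mem_slitPlane (circle_norm_lt hr hr' s)

theorem circle_one_mem (hr : 0 < r) (hr' : r < 1 / 2) {x y : affineCurve t} (γ : Path x y)
    (h : ∀ s, (γ s).1.1 = 1 - r * Complex.exp (2 * Real.pi * Complex.I * (s : ℝ)))
    (s : unitInterval) : compactPath γ s ∈ discOne t := by
  change toCompact t (γ s) ∈ _
  rw [toCompact_mem_discOne, h]
  exact one_sub_mem_slitPlane (circle_norm_lt hr hr' s)

theorem q_mem (hr : 0 < r) (hr' : r < 1 / 2) (j : Fin 3) :
    toCompact t (D.q j) ∈ discZero t ∩ discOne t := by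
  simpa using D.segment_mem hr hr' j 0

/-- Over the doubly slit plane ζ = μ · `cbrt` z · `cbrt` (1 - z) with μ³ = t. The ratio of two such
μ is a power of ε, so the three marked points represent all the sheets. -/
theorem joinedIn_q (ht : t ≠ 0) (hr : 0 < r) (hr' : r < 1 / 2) {x : compactCurve t}
    (hx : x ∈ discZero t ∩ discOne t) :
    ∃ j, JoinedIn (discZero t ∩ discOne t) (toCompact t (D.q j)) x := by
  obtain ⟨b, -, hb⟩ := hx.1
  have root : ∀ a : ℂ × ℂ, a.2 ^ 3 = t * (a.1 * (1 - a.1)) → a.1 ∈ Complex.slitPlane →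
      1 - a.1 ∈ Complex.slitPlane →
      ∃ μ, μ ^ 3 = t ∧ a.2 = μ * cbrt a.1 * cbrt (1 - a.1) := by
    intro a h h0 h1
    replace h0 := Complex.slitPlane_ne_zero h0
    replace h1 := Complex.slitPlane_ne_zero h1
    have h2 := cbrt_ne_zero h0
    have h3 := cbrt_ne_zero h1
    refine ⟨a.2 / (cbrt a.1 * cbrt (1 - a.1)), ?_, ?_⟩
    · simp only [div_pow, mul_pow, cbrt_pow, h]
      field_simp
    · field_simp
  have hxc := x.2
  rw [← hb, chartZ_mem_compactCurve] at hxc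
  obtain ⟨ν, hν, hbν⟩ := root b hxc ((mem_discOne hb).1 hx.2) ((mem_discZero hb).1 hx.1)
  have hq := D.q_mem hr hr'
  obtain ⟨μ, hμ, hqμ⟩ := root (D.q 0).1 (affineCurve_iff.1 (D.q 0).2)
    (toCompact_mem_discOne.1 (hq 0).2) (toCompact_mem_discZero.1 (hq 0).1)
  have hμ0 : μ ≠ 0 := fun h => ht (by rw [← hμ, h]; simp)
  obtain ⟨j, hj⟩ := exists_eq_ε_pow (u := ν / μ) (by rw [div_pow, hν, hμ, div_self ht])
  rw [div_eq_iff hμ0] at hj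
  refine ⟨j, joinedIn_sheet (a := (D.q j).1) hν rfl hb (hq j) hx ?_ hbν⟩
  rw [D.q_snd, hqμ, D.q_fst, D.q_fst, hj]
  ring

/-- A homomorphism on `1`-chains which vanishes on both cycles vanishes on homology. -/
theorem hom_eq_zero (ht : t ≠ 0) (hr : 0 < r) (hr' : r < 1 / 2) {M : Type} [AddCommGroup M]
    (T : ChainsModBoundaries (compactCurve t) →ₗ[ℤ] M)
    (hA : T (pathClass (compactPath D.loopA)) = 0) (hB : T (pathClass (compactPath D.loopB)) = 0)
    (a : H1 (compactCurve t)) : T (homologyToChains _ a) = 0 := by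
  obtain ⟨g, hg⟩ := exists_isPrimitiveOn_univ ht T (by
    intro g g' h h'
    have hf := fun j => h (compactPath (D.f j)) fun s => (D.segment_mem hr hr' j s).1
    rw [D.pathClass_loopA, map_sub, map_sub, map_add, hf, hf,
      h _ (circle_zero_mem hr hr' D.γ0 D.γ0_lift),
      h' _ (circle_one_mem hr hr' D.γ1 D.γ1_lift)] at hA
    rw [D.pathClass_loopB, map_sub, map_sub, map_add, hf, hf,
      h _ (circle_zero_mem hr hr' D.γ0' D.γ0'_lift),
      h' _ (circle_one_mem hr hr' D.γ1' D.γ1'_lift)] at hB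
    -- Expanding T along A, every piece but the circle around 1 is integrated with g, and that
    -- circle with g'. The values at the points p cancel, leaving T(A) = k 0 - k 1; likewise T(B) =
    -- k 1 - k 2.
    let k := fun j => g' (toCompact t (D.q j)) - g (toCompact t (D.q j))
    have h1 : k 1 = k 0 := by
      rw [← sub_eq_zero, ← neg_eq_zero, ← hA]
      simp only [k]
      abel
    have h2 : k 2 = k 1 := by
      rw [← sub_eq_zero, ← neg_eq_zero, ← hB]
      simp only [k]
      abel
    refine ⟨k 0, fun x hx => ?_⟩
    obtain ⟨j, hj⟩ := D.joinedIn_q ht hr hr' hx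
    rw [(h'.mono Set.inter_subset_right).sub_eq_sub (h.mono Set.inter_subset_left) hj]
    change k j = k 0
    fin_cases j
    exacts [rfl, h1, h2.trans h1])
  exact hg.comp_homologyToChains a

theorem homologyToChains_A : homologyToChains _ D.A = pathClass (compactPath D.loopA) :=
  homologyToChains_loopClass _

theorem homologyToChains_B : homologyToChains _ D.B = pathClass (compactPath D.loopB) :=
  homologyToChains_loopClass _

theorem span_eq_top (ht : t ≠ 0) (hr : 0 < r) (hr' : r < 1 / 2) :
    Submodule.span ℤ (Set.range ![D.A, D.B]) = ⊤ := by
  rw [Submodule.eq_top_iff']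
  intro a
  let N : Submodule ℤ (ChainsModBoundaries (compactCurve t)) :=
    (Submodule.span ℤ (Set.range ![D.A, D.B])).map (homologyToChains _)
  let T : ChainsModBoundaries (compactCurve t) →ₗ[ℤ] (ChainsModBoundaries (compactCurve t) ⧸ N) :=
    { toFun := N.mkQ.toAddMonoidHom
      map_add' := map_add _
      map_smul' := fun n c => map_intCast_smul N.mkQ.toAddMonoidHom ℤ ℤ n c }
  have hN : ∀ c, T c = 0 ↔ c ∈ N := fun c =>
    Submodule.Quotient.mk_eq_zero N
  have hA : homologyToChains _ D.A ∈ N :=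
    Submodule.mem_map_of_mem (Submodule.subset_span ⟨0, rfl⟩)
  have hB : homologyToChains _ D.B ∈ N :=
    Submodule.mem_map_of_mem (Submodule.subset_span ⟨1, rfl⟩)
  rw [homologyToChains_A] at hA
  rw [homologyToChains_B] at hB
  have h := D.hom_eq_zero ht hr hr' T ((hN _).2 hA)
    ((hN _).2 hB) a
  obtain ⟨b, hb, hab⟩ := (hN _).1 h
  rwa [← homologyToChains_injective hab]

end SheetLifts

end Cycles

/-! ### A nowhere vanishing function on the compact curve. -/

section CircleMap

open ComplexConjugate

/-- If both parts vanish, v = x + 1 is on the unit circle and y = z - 1/2 satisfies y · conj v = i s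
with s real. As x³ = 1/4 - y², this gives (v - 1)³ = 1/4 + s²v². -/
theorem not_vanishing {x z : ℂ} (h : x ^ 3 = z * (1 - z))
    (h0 : Complex.normSq x + 2 * x.re = 0) : ((z - 1 / 2) * conj (x + 1)).re ≠ 0 := by
  intro h1
  obtain ⟨v, rfl⟩ : ∃ v, x = v - 1 := ⟨x + 1, by ring⟩
  obtain ⟨y, rfl⟩ : ∃ y, z = y + 1 / 2 := ⟨z - 1 / 2, by ring⟩
  have hv : v.re ^ 2 + v.im ^ 2 = 1 := by
    rw [Complex.normSq_apply] at h0
    simp at h0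
    linarith
  have hvv : v * conj v = 1 := by
    rw [Complex.mul_conj, Complex.normSq_apply, ← Complex.ofReal_one, ← hv]
    push_cast
    ring
  rw [sub_add_cancel, add_sub_cancel_right] at h1
  set s := (y * conj v).im with hs
  have hy : y * conj v = s * Complex.I := by
    apply Complex.ext
    · simpa using h1
    · simp [hs]
  -- The cubic relation multiplied by conj v², using v · conj v = 1. Its imaginary part forces v =
  -- 1, v = -1 or Re v = 4/5; in each case the real part is s² plus a positive constant.
  have key : (5 / 4 : ℂ) * conj v ^ 2 - v - 3 * conj v + 3 + (s : ℂ) ^ 2 = 0 := by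
    have hy2 : (y * conj v) ^ 2 = -(s : ℂ) ^ 2 := by
      rw [hy, mul_pow, Complex.I_sq]
      ring
    linear_combination -conj v ^ 2 * h + hy2 + ((v - 3) * (v * conj v + 1) + 3 * conj v) * hvv
  have hre := congrArg Complex.re key
  have him := congrArg Complex.im key
  simp [pow_two] at hre him
  have h2 : v.im * (4 - 5 * v.re) = 0 := by linear_combination 2 * him
  rcases mul_eq_zero.1 h2 with h3 | h3
  · have h4 : (v.re - 1) * (v.re + 1) = 0 := by
      rw [h3] at hv
      linear_combination hv
    rw [h3] at hre
    rcases mul_eq_zero.1 h4 with h5 | h5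
    · obtain h5 : v.re = 1 := by linarith
      rw [h5] at hre
      nlinarith [sq_nonneg s]
    · obtain h5 : v.re = -1 := by linarith
      rw [h5] at hre
      nlinarith [sq_nonneg s]
  · have h5 : v.re = 4 / 5 := by linarith
    rw [h5] at hre hv
    nlinarith [sq_nonneg s]

/-- A function without zeros on the curve `ζ³ = κ³ z (1 - z)`. -/
def nonvanishing (κ : ℂ) (a : ℂ × ℂ) : ℂ :=
  -- The denominators control the growth at infinity. There x has a pole of order 2 and z one of
  -- order 3, so the first quotient tends to 1 and the second, of orders 5 over 8, tends to 0.
  ⟨(Complex.normSq (a.2 / κ) + 2 * (a.2 / κ).re) / (1 + Complex.normSq (a.2 / κ)),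
    ((a.1 - 1 / 2) * conj (a.2 / κ + 1)).re / (1 + Complex.normSq (a.2 / κ) ^ 2)⟩

/-- The expression of `nonvanishing` near infinity. -/
def nonvanishingInfinity (κ : ℂ) (b : ℂ × ℂ) : ℂ :=
  -- On the curve, g is 1/x away from w = 0 and w = 1, rewritten by the equation to be regular at w
  -- = 0. Likewise -η/(κ(1 - w)) replaces g²/w.
  let g := -b.2 ^ 2 / (κ ^ 2 * (1 - b.1))
  ⟨(1 + 2 * g.re) / (1 + Complex.normSq g),
    ((1 - b.1 / 2) * (-b.2 / (κ * (1 - b.1))) * (conj g * (1 + conj g))).re /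
      (1 + Complex.normSq g ^ 2)⟩

theorem continuous_complexMk {A : Type*} [TopologicalSpace A] {f g : A → ℝ} {s : Set A}
    (hf : ContinuousOn f s) (hg : ContinuousOn g s) :
    ContinuousOn (fun a => (⟨f a, g a⟩ : ℂ)) s :=
  Complex.equivRealProdCLM.symm.continuous.comp_continuousOn (hf.prodMk hg)

theorem continuous_nonvanishing (κ : ℂ) : Continuous (nonvanishing κ) := by
  rw [← continuousOn_univ]
  have h := Complex.continuous_normSq
  refine continuous_complexMk ?_ ?_
  · refine Continuous.continuousOn (Continuous.div (by fun_prop) (by fun_prop) fun a => ?_)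
    positivity [Complex.normSq_nonneg (a.2 / κ)]
  · refine Continuous.continuousOn (Continuous.div ?_ (by fun_prop) fun a => ?_)
    · exact Complex.continuous_re.comp ((by fun_prop : Continuous fun a : ℂ × ℂ =>
        a.1 - 1 / 2).mul (Complex.continuous_conj.comp (by fun_prop)))
    · positivity

theorem continuousOn_nonvanishingInfinity {κ : ℂ} (hκ : κ ≠ 0) :
    ContinuousOn (nonvanishingInfinity κ) {b | 1 - b.1 ≠ 0} := by
  have h := Complex.continuous_normSq
  have hg : ContinuousOn (fun b : ℂ × ℂ => -b.2 ^ 2 / (κ ^ 2 * (1 - b.1))) {b | 1 - b.1 ≠ 0} :=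
    ContinuousOn.div (by fun_prop) (by fun_prop) fun b hb => mul_ne_zero (pow_ne_zero 2 hκ) hb
  have hg' : ContinuousOn (fun b : ℂ × ℂ => -b.2 / (κ * (1 - b.1))) {b | 1 - b.1 ≠ 0} :=
    ContinuousOn.div (by fun_prop) (by fun_prop) fun b hb => mul_ne_zero hκ hb
  have hc := Complex.continuous_conj.comp_continuousOn hg
  refine continuous_complexMk ?_ ?_
  · refine ContinuousOn.div (continuousOn_const.add (continuousOn_const.mul
      (Complex.continuous_re.comp_continuousOn hg)))
      (continuousOn_const.add (h.comp_continuousOn hg)) fun b _ => ?_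
    exact (add_pos_of_pos_of_nonneg one_pos (Complex.normSq_nonneg _)).ne'
  · refine ContinuousOn.div (Complex.continuous_re.comp_continuousOn ?_)
      (continuousOn_const.add ((h.comp_continuousOn hg).pow 2)) fun b _ => ?_
    · exact (ContinuousOn.mul (by fun_prop) hg').mul (hc.mul (continuousOn_const.add hc))
    · exact (add_pos_of_pos_of_nonneg one_pos (sq_nonneg _)).ne'

theorem nonvanishing_transition {κ : ℂ} (hκ : κ ≠ 0) {b : ℂ × ℂ} (h0 : b.1 ≠ 0)
    (h1 : 1 - b.1 ≠ 0) (hb : b.2 ^ 3 = -κ ^ 3 * (b.1 * (1 - b.1))) :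
    nonvanishing κ (transition b) = nonvanishingInfinity κ b := by
  obtain ⟨w, η⟩ := b
  simp only at h0 h1 hb
  have hη : η ≠ 0 := fun h => by
    rw [h] at hb
    have : -κ ^ 3 * (w * (1 - w)) ≠ 0 :=
      mul_ne_zero (neg_ne_zero.2 (pow_ne_zero 3 hκ)) (mul_ne_zero h0 h1)
    exact this (by rw [← hb]; ring)
  set g := -η ^ 2 / (κ ^ 2 * (1 - w)) with hg
  have hg0 : g ≠ 0 := div_ne_zero (neg_ne_zero.2 (pow_ne_zero 2 hη))
    (mul_ne_zero (pow_ne_zero 2 hκ) h1)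
  have hx : w⁻¹ * η / κ = g⁻¹ := by
    rw [hg]
    field_simp
    linear_combination hb
  have hh : -η / (κ * (1 - w)) = g ^ 2 / w := by
    rw [hg]
    field_simp
    linear_combination -hb
  have hn : Complex.normSq g ≠ 0 := (Complex.normSq_pos.2 hg0).ne'
  have hn' := Complex.normSq_nonneg g
  have hd1 : 1 + Complex.normSq g ≠ 0 := by positivity
  have hd2 : 1 + Complex.normSq g ^ 2 ≠ 0 := by positivity
  have hcg : conj g ≠ 0 := (map_ne_zero _).2 hg0
  unfold nonvanishing nonvanishingInfinity transition
  simp only [← hg, hx, hh]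
  congr 1
  · rw [map_inv₀, Complex.inv_re]
    field_simp
    ring
  · have e : (1 - w / 2) * (g ^ 2 / w) * (conj g * (1 + conj g)) =
        ((Complex.normSq g ^ 2 : ℝ) : ℂ) * ((w⁻¹ - 1 / 2) * conj (g⁻¹ + 1)) := by
      push_cast
      rw [← Complex.mul_conj, map_add, map_inv₀, map_one]
      field_simp
    rw [e, Complex.re_ofReal_mul, map_inv₀]
    field_simp
    ring

theorem nonvanishing_ne_zero {κ : ℂ} (hκ : κ ≠ 0) {a : ℂ × ℂ}
    (ha : a.2 ^ 3 = κ ^ 3 * (a.1 * (1 - a.1))) : nonvanishing κ a ≠ 0 := by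
  intro h
  have hn := Complex.normSq_nonneg (a.2 / κ)
  have h1 := congrArg Complex.re h
  have h2 := congrArg Complex.im h
  simp only [nonvanishing, Complex.zero_re, Complex.zero_im] at h1 h2
  rw [div_eq_zero_iff, or_iff_left (by positivity)] at h1 h2
  refine not_vanishing ?_ h1 h2
  rw [div_pow, ha]
  field_simp

theorem nonvanishing_reflect (κ : ℂ) (a : ℂ × ℂ) :
    nonvanishing κ (1 - a.1, a.2) = conj (nonvanishing κ a) := by
  apply Complex.ext
  · rfl
  · change ((1 - a.1 - 1 / 2) * _).re / _ = -(_ / _)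
    rw [← neg_div, ← Complex.neg_re, ← neg_mul]
    congr 3
    ring

/-- The continuous extension of `nonvanishing` to the compactified curve. -/
def globalNonvanishing (t κ : ℂ) (x : compactCurve t) : ℂ := by
  classical
  -- The value 1 is the limit at infinity, the only point outside the z-chart.
  exact if x.1 ∈ Set.range chartZ then nonvanishing κ (Function.invFun chartZ x.1) else 1

theorem globalNonvanishing_chartZ {t κ : ℂ} {x : compactCurve t} {a : ℂ × ℂ}
    (h : chartZ a = x) : globalNonvanishing t κ x = nonvanishing κ a := by
  unfold globalNonvanishing
  rw [if_pos ⟨a, h⟩, ← h, Function.leftInverse_invFun chartZ_injective]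

theorem globalNonvanishing_infinity {t κ : ℂ} {x : compactCurve t} (h : x.1 = chartW (0, 0)) :
    globalNonvanishing t κ x = 1 := by
  unfold globalNonvanishing
  rw [if_neg]
  rw [h]
  rintro ⟨a, ha⟩
  simpa using (chartZ_eq_chartW.1 ha).1

theorem globalNonvanishing_chartW {t κ : ℂ} (hκ : κ ^ 3 = t) (ht : t ≠ 0) {x : compactCurve t}
    {b : ℂ × ℂ} (h : chartW b = x) (h1 : 1 - b.1 ≠ 0) :
    globalNonvanishing t κ x = nonvanishingInfinity κ b := by
  have hx := x.2
  rw [← h, chartW_mem_compactCurve] at hx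
  by_cases hb : b.1 = 0
  · have hb2 : b.2 = 0 := by simpa [hb] using hx
    rw [globalNonvanishing_infinity (by rw [← h, ← Prod.mk.eta (p := b), hb, hb2])]
    apply Complex.ext <;> simp [nonvanishingInfinity, hb2]
  · rw [globalNonvanishing_chartZ ((chartZ_transition hb).trans h),
      nonvanishing_transition (fun h0 => ht (by rw [← hκ, h0]; simp)) hb h1 (by rw [hx, hκ])]

theorem continuousAt_invFun {E : ℂ × ℂ → TotL} (hE : Topology.IsOpenEmbedding E) (a : ℂ × ℂ) :
    ContinuousAt (Function.invFun E) (E a) := by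
  rw [← hE.continuousAt_iff]
  exact continuousAt_id.congr (Filter.Eventually.of_forall fun a =>
    (Function.leftInverse_invFun hE.injective a).symm)

theorem continuousAt_of_chart {t : ℂ} {E : ℂ × ℂ → TotL} (hE : Topology.IsOpenEmbedding E)
    {φ : compactCurve t → ℂ} {ψ : ℂ × ℂ → ℂ} {S : Set (ℂ × ℂ)} (hS : IsOpen S)
    (h : ∀ x a, E a = x.1 → a ∈ S → φ x = ψ a) (hψ : ContinuousOn ψ S) {x : compactCurve t}
    {a : ℂ × ℂ} (hx : E a = x) (ha : a ∈ S) : ContinuousAt φ x := by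
  have h1 : ContinuousAt (fun y : compactCurve t => ψ (Function.invFun E y.1)) x := by
    have e : Function.invFun E x.1 = a := by rw [← hx, Function.leftInverse_invFun hE.injective]
    refine ContinuousAt.comp (g := ψ) (f := fun y : compactCurve t => Function.invFun E y.1) ?_ ?_
    · rw [e]
      exact hψ.continuousAt (hS.mem_nhds ha)
    · refine ContinuousAt.comp (g := Function.invFun E) ?_ continuousAt_subtype_val
      rw [← hx]
      exact continuousAt_invFun hE a
  refine h1.congr ?_
  filter_upwards [((hE.isOpenMap _ hS).preimage continuous_subtype_val).mem_nhds
    (⟨a, ha, hx⟩ : x ∈ Subtype.val ⁻¹' (E '' S))] with y hy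
  obtain ⟨b, hb, hby⟩ := hy
  rw [h y b hby hb, ← hby, Function.leftInverse_invFun hE.injective]

theorem continuous_globalNonvanishing {t κ : ℂ} (hκ : κ ^ 3 = t) (ht : t ≠ 0) :
    Continuous (globalNonvanishing t κ) := by
  rw [continuous_iff_continuousAt]
  intro x
  rcases exists_chart_of_mem_compactCurve x.2 with ⟨a, ha⟩ | hx
  · exact continuousAt_of_chart isOpenEmbedding_chartZ isOpen_univ
      (fun x a h _ => globalNonvanishing_chartZ h) (continuous_nonvanishing κ).continuousOn ha
      trivial
  · exact continuousAt_of_chart isOpenEmbedding_chartW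
      (isOpen_ne_fun (f := fun b : ℂ × ℂ => 1 - b.1) (by fun_prop) continuous_const)
      (fun x b h hb => globalNonvanishing_chartW hκ ht h hb)
      (continuousOn_nonvanishingInfinity fun h0 => ht (by rw [← hκ, h0]; simp)) hx.symm
      (by simp)

theorem globalNonvanishing_ne_zero {t κ : ℂ} (hκ : κ ^ 3 = t) (ht : t ≠ 0) (x : compactCurve t) :
    globalNonvanishing t κ x ≠ 0 := by
  rcases exists_chart_of_mem_compactCurve x.2 with ⟨a, ha⟩ | hx
  · have hx := x.2
    rw [← ha, chartZ_mem_compactCurve, ← hκ] at hx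
    rw [globalNonvanishing_chartZ ha]
    exact nonvanishing_ne_zero (fun h0 => ht (by rw [← hκ, h0]; simp)) hx
  · rw [globalNonvanishing_infinity hx]
    exact one_ne_zero

/-- The circle-valued map on the compactified curve given by the argument of `nonvanishing`. -/
def circleMap {t κ : ℂ} (hκ : κ ^ 3 = t) (ht : t ≠ 0) : C(compactCurve t, Circle) where
  toFun x := ⟨globalNonvanishing t κ x / ‖globalNonvanishing t κ x‖, mem_sphere_zero_iff_norm.2 (by
    rw [norm_div, Complex.norm_real, norm_norm,
      div_self (norm_ne_zero_iff.2 (globalNonvanishing_ne_zero hκ ht x))])⟩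
  continuous_toFun := by
    have h := continuous_globalNonvanishing hκ ht
    exact Continuous.subtype_mk (h.div (Complex.continuous_ofReal.comp h.norm) fun x =>
      Complex.ofReal_ne_zero.2 (norm_ne_zero_iff.2 (globalNonvanishing_ne_zero hκ ht x))) _

theorem circleMap_coe {t κ : ℂ} (hκ : κ ^ 3 = t) (ht : t ≠ 0) (a : affineCurve t) :
    (circleMap hκ ht (toCompact t a) : ℂ) = nonvanishing κ a.1 / ‖nonvanishing κ a.1‖ := by
  rw [← globalNonvanishing_chartZ (x := toCompact t a) rfl]
  rfl

theorem circleMap_reflect {t κ : ℂ} (hκ : κ ^ 3 = t) (ht : t ≠ 0) {a b : affineCurve t}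
    (h1 : b.1.1 = 1 - a.1.1) (h2 : b.1.2 = a.1.2) :
    circleMap hκ ht (toCompact t b) = (circleMap hκ ht (toCompact t a))⁻¹ := by
  apply Circle.ext
  have hb : b.1 = (1 - a.1.1, a.1.2) := Prod.ext h1 h2
  rw [Circle.coe_inv_eq_conj, circleMap_coe, circleMap_coe, hb, nonvanishing_reflect, map_div₀,
    Complex.conj_ofReal, Complex.norm_conj]

theorem nonvanishing_half (κ ζ : ℂ) : nonvanishing κ (1 / 2, ζ) =
    (((Complex.normSq (ζ / κ) + 2 * (ζ / κ).re) / (1 + Complex.normSq (ζ / κ)) : ℝ) : ℂ) := by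
  apply Complex.ext
  · rfl
  · rw [Complex.ofReal_im]
    simp [nonvanishing]

/-- The real number `4 ^ (-1/3)`. -/
theorem exists_cube_root_quarter : ∃ e : ℝ, 0 < e ∧ e < 1 ∧ e ^ 3 = 1 / 4 := by
  refine ⟨(1 / 4 : ℝ) ^ ((3 : ℕ) : ℝ)⁻¹, by positivity,
    Real.rpow_lt_one (by norm_num) (by norm_num) (by norm_num),
    Real.rpow_inv_natCast_pow (by norm_num) three_ne_zero⟩

theorem circleMap_eq_one {t κ : ℂ} (hκ : κ ^ 3 = t) (ht : t ≠ 0) {a : affineCurve t} {e : ℝ}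
    (he : 0 < e) (h1 : a.1.1 = 1 / 2) (h2 : a.1.2 / κ = e) :
    circleMap hκ ht (toCompact t a) = 1 := by
  apply Circle.ext
  have ha : a.1 = (1 / 2, a.1.2) := Prod.ext h1 rfl
  rw [circleMap_coe, ha, nonvanishing_half, h2, Complex.normSq_ofReal, Complex.ofReal_re,
    Complex.norm_real, Real.norm_of_nonneg (by positivity), div_self, Circle.coe_one]
  exact Complex.ofReal_ne_zero.2 (by positivity)

/-- Over z = 1/2 the function is real with the sign of |x|² + 2 Re x. For x = εe or ε²e this is e² -
e, negative because e < 1. -/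
theorem circleMap_eq_neg_one {t κ : ℂ} (hκ : κ ^ 3 = t) (ht : t ≠ 0) {a : affineCurve t} {e : ℝ}
    (he : 0 < e) (he1 : e < 1) (h1 : a.1.1 = 1 / 2)
    (h2 : a.1.2 / κ = ε * e ∨ a.1.2 / κ = ε ^ 2 * e) :
    circleMap hκ ht (toCompact t a) = -1 := by
  have hε : ε = ⟨-1 / 2, √3 / 2⟩ := by
    have : (2 * Real.pi * Complex.I / 3 : ℂ) = ((Real.pi - Real.pi / 3 : ℝ) : ℂ) * Complex.I := by
      push_cast
      ring
    rw [ε, this]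
    apply Complex.ext
    · rw [Complex.exp_ofReal_mul_I_re, Real.cos_pi_sub, Real.cos_pi_div_three]
      norm_num
    · rw [Complex.exp_ofReal_mul_I_im, Real.sin_pi_sub, Real.sin_pi_div_three]
  have h3 : √3 ^ 2 = 3 := Real.sq_sqrt (by norm_num)
  have hv : nonvanishing κ (1 / 2, a.1.2) = (((e ^ 2 - e) / (1 + e ^ 2) : ℝ) : ℂ) := by
    rw [nonvanishing_half]
    congr 1
    rcases h2 with h2 | h2
    · have hn : Complex.normSq (a.1.2 / κ) = e ^ 2 := by
        rw [h2, hε, Complex.normSq_apply]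
        simp
        linear_combination e ^ 2 / 4 * h3
      have hr : (a.1.2 / κ).re = -e / 2 := by
        rw [h2, hε]
        simp
        ring
      rw [hn, hr]
      ring
    · have hn : Complex.normSq (a.1.2 / κ) = e ^ 2 := by
        rw [h2, hε, Complex.normSq_apply]
        simp [pow_two]
        linear_combination e ^ 2 / 16 * (√3 ^ 2 + 5) * h3
      have hr : (a.1.2 / κ).re = -e / 2 := by
        rw [h2, hε]
        simp [pow_two]
        linear_combination -e / 4 * h3
      rw [hn, hr]
      ring
  have hneg : (e ^ 2 - e) / (1 + e ^ 2) < 0 :=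
    div_neg_of_neg_of_pos (by nlinarith) (by positivity)
  apply Circle.ext
  have ha : a.1 = (1 / 2, a.1.2) := Prod.ext h1 rfl
  rw [circleMap_coe, ha, hv, Complex.norm_real, Real.norm_of_nonpos hneg.le, Complex.ofReal_neg,
    div_neg, div_self, Circle.coe_neg, Circle.coe_one]
  exact Complex.ofReal_ne_zero.2 hneg.ne

end CircleMap

/-! ### Windings of A and B, and linear independence. -/

section Independence

/-- The quotient u/v is continuous on a connected interval with values in the finite set of cube
roots of unity, hence constant. -/
theorem eq_of_cube_eq {u v : unitInterval → ℂ} (hu : Continuous u) (hv : Continuous v)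
    (h0 : ∀ s, v s ≠ 0) (h : ∀ s, u s ^ 3 = v s ^ 3) {s₀ : unitInterval} (hs : u s₀ = v s₀)
    (s : unitInterval) : u s = v s := by
  have hfin : {c : ℂ | c ^ 3 = 1}.Finite := by
    refine (Set.finite_range fun j : Fin 3 => ε ^ (j : ℕ)).subset fun c hc => ?_
    obtain ⟨j, hj⟩ := exists_eq_ε_pow hc
    exact ⟨j, hj.symm⟩
  have := (isPreconnected_univ (α := unitInterval)).constant_of_mapsTo (f := fun s => u s / v s)
    hfin.isDiscrete (hu.div hv h0).continuousOn (fun s _ => by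
      change (u s / v s) ^ 3 = 1
      rw [div_pow, h, div_self (pow_ne_zero 3 (h0 s))]) (Set.mem_univ s) (Set.mem_univ s₀)
  rwa [hs, div_self (h0 _), div_eq_one_iff_eq (h0 s)] at this

variable {t : ℂ} {r : ℝ}

namespace SheetLifts

variable (D : SheetLifts t r)

/-- The midpoint of the unit interval. -/
def midpoint : unitInterval := ⟨1 / 2, by norm_num, by norm_num⟩

theorem symm_midpoint : unitInterval.symm midpoint = midpoint := by
  apply Subtype.ext
  rw [unitInterval.coe_symm_eq]
  norm_num [midpoint]

theorem snd_ne_zero (ht : t ≠ 0) {a : affineCurve t} (h0 : a.1.1 ≠ 0) (h1 : 1 - a.1.1 ≠ 0) :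
    a.1.2 ≠ 0 := fun h => by
  have := affineCurve_iff.1 a.2
  rw [h] at this
  exact mul_ne_zero ht (mul_ne_zero h0 h1) (by rw [← this]; simp)

theorem segment_reflect_fst (j : Fin 3) (s : unitInterval) :
    (D.f j (unitInterval.symm s)).1.1 = 1 - (D.f j s).1.1 := by
  rw [D.f_lift, D.f_lift, unitInterval.coe_symm_eq]
  push_cast
  ring

/-- The equation is invariant under z ↦ 1 - z, so ζ and its reversal have equal cubes, and they
coincide at the midpoint. -/
theorem segment_reflect_snd (ht : t ≠ 0) (hr : 0 < r) (hr' : r < 1 / 2) (j : Fin 3)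
    (s : unitInterval) : (D.f j (unitInterval.symm s)).1.2 = (D.f j s).1.2 := by
  have hc : Continuous fun s => (D.f j s).1.2 :=
    continuous_snd.comp (continuous_subtype_val.comp (D.f j).continuous)
  refine eq_of_cube_eq (u := fun s => (D.f j (unitInterval.symm s)).1.2)
    (hc.comp unitInterval.continuous_symm) hc (fun s => ?_) (fun s => ?_) (s₀ := midpoint)
    (by simp only [symm_midpoint]) s
  · have := D.segment_mem hr hr' j s
    exact snd_ne_zero ht (Complex.slitPlane_ne_zero (toCompact_mem_discOne.1 this.2))
      (Complex.slitPlane_ne_zero (toCompact_mem_discZero.1 this.1))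
  · rw [affineCurve_iff.1 (D.f j s).2, affineCurve_iff.1 (D.f j (unitInterval.symm s)).2,
      D.segment_reflect_fst]
    ring

theorem q_snd_eq_p_snd (ht : t ≠ 0) (hr : 0 < r) (hr' : r < 1 / 2) (j : Fin 3) :
    (D.q j).1.2 = (D.p j).1.2 := by
  have := D.segment_reflect_snd ht hr hr' j 1
  simpa using this

theorem circle_reflect_snd (ht : t ≠ 0) (hr : 0 < r) (hr' : r < 1 / 2) {p p' q q' : affineCurve t}
    (γ : Path p p') (δ : Path q q')
    (hγ : ∀ s, (γ s).1.1 = r * Complex.exp (2 * Real.pi * Complex.I * (s : ℝ)))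
    (hδ : ∀ s, (δ s).1.1 = 1 - r * Complex.exp (2 * Real.pi * Complex.I * (s : ℝ)))
    (hpq : q.1.2 = p.1.2) (s : unitInterval) : (δ s).1.2 = (γ s).1.2 := by
  refine eq_of_cube_eq (u := fun s => (δ s).1.2) (v := fun s => (γ s).1.2)
    (continuous_snd.comp (continuous_subtype_val.comp δ.continuous))
    (continuous_snd.comp (continuous_subtype_val.comp γ.continuous))
    (fun s => ?_) (fun s => ?_) (s₀ := 0) (by simpa using hpq) s
  · refine snd_ne_zero ht ?_ ?_
    · rw [hγ]
      exact mul_ne_zero (Complex.ofReal_ne_zero.2 hr.ne') (Complex.exp_ne_zero _)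
    · rw [hγ]
      exact Complex.slitPlane_ne_zero (one_sub_mem_slitPlane (circle_norm_lt hr hr' s))
  · rw [affineCurve_iff.1 (δ s).2, affineCurve_iff.1 (γ s).2, hγ, hδ]
    ring

/-- The circle lifts γ and δ are reflections of each other, so their windings are opposite and
together count twice that of γ. Each segment lift is its own reversed reflection, so half its
winding is that of its second half. The values of F at the points p cancel. -/
theorem exp_half_winding_loop {κ : ℂ} (hκ : κ ^ 3 = t) (ht : t ≠ 0) (hr : 0 < r)
    (hr' : r < 1 / 2) (i j : Fin 3) (γ : Path (D.p i) (D.p j)) (δ : Path (D.q i) (D.q j))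
    (hγ : ∀ s, (γ s).1.1 = r * Complex.exp (2 * Real.pi * Complex.I * (s : ℝ)))
    (hδ : ∀ s, (δ s).1.1 = 1 - r * Complex.exp (2 * Real.pi * Complex.I * (s : ℝ))) :
    Circle.exp (winding (circleMap hκ ht) (pathClass (compactPath (D.f i)) +
      pathClass (compactPath γ) - pathClass (compactPath (D.f j)) -
        pathClass (compactPath δ)) / 2) =
      circleMap hκ ht (toCompact t (D.f j midpoint)) /
        circleMap hκ ht (toCompact t (D.f i midpoint)) := by
  set F := circleMap hκ ht
  have hf : ∀ k, Circle.exp (winding F (pathClass (compactPath (D.f k))) / 2) =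
      F (toCompact t (D.p k)) / F (toCompact t (D.f k midpoint)) := fun k =>
    exp_half_winding F (compactPath (D.f k)) (fun s =>
      circleMap_reflect hκ ht (D.segment_reflect_fst k s) (D.segment_reflect_snd ht hr hr' k s))
      midpoint symm_midpoint
  have h1 : winding F (pathClass (compactPath δ)) = -winding F (pathClass (compactPath γ)) :=
    winding_of_inv F (compactPath γ) (compactPath δ) fun s =>
      circleMap_reflect hκ ht (by rw [hγ, hδ]) (circle_reflect_snd ht hr hr' γ δ hγ hδ
        (D.q_snd_eq_p_snd ht hr hr' i) s)
  have h2 := exp_winding F (compactPath γ)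
  rw [map_sub, map_sub, map_add, h1]
  rw [show ∀ a b c : ℝ, (a + b - c - -b) / 2 = a / 2 + b - c / 2 from fun a b c => by ring,
    Circle.exp_sub, Circle.exp_add, hf, hf, h2]
  rw [div_mul_div_cancel', div_div_div_cancel_left]

theorem exp_half_winding_A {κ : ℂ} (hκ : κ ^ 3 = t) (ht : t ≠ 0) (hr : 0 < r) (hr' : r < 1 / 2) :
    Circle.exp (winding (circleMap hκ ht) (homologyToChains _ D.A) / 2) =
      circleMap hκ ht (toCompact t (D.f 1 midpoint)) /
        circleMap hκ ht (toCompact t (D.f 0 midpoint)) := by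
  rw [homologyToChains_A, pathClass_loopA]
  exact D.exp_half_winding_loop hκ ht hr hr' 0 1 D.γ0 D.γ1 D.γ0_lift D.γ1_lift

theorem exp_half_winding_B {κ : ℂ} (hκ : κ ^ 3 = t) (ht : t ≠ 0) (hr : 0 < r) (hr' : r < 1 / 2) :
    Circle.exp (winding (circleMap hκ ht) (homologyToChains _ D.B) / 2) =
      circleMap hκ ht (toCompact t (D.f 2 midpoint)) /
        circleMap hκ ht (toCompact t (D.f 1 midpoint)) := by
  rw [homologyToChains_B, pathClass_loopB]
  exact D.exp_half_winding_loop hκ ht hr hr' 1 2 D.γ0' D.γ1' D.γ0'_lift D.γ1'_lift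

theorem exists_odd_of_exp_half {w : ℝ} (h : Circle.exp (w / 2) = -1) :
    ∃ n : ℤ, w = (2 * n + 1 : ℤ) * (2 * Real.pi) := by
  have hpi : Circle.exp Real.pi = -1 := Circle.ext (by simp)
  rw [← hpi, Circle.exp_eq_exp] at h
  obtain ⟨n, hn⟩ := h
  refine ⟨n, ?_⟩
  push_cast
  linarith

theorem exists_even_of_exp_half {w : ℝ} (h : Circle.exp (w / 2) = 1) :
    ∃ n : ℤ, w = (2 * n : ℤ) * (2 * Real.pi) := by
  obtain ⟨n, hn⟩ := Circle.exp_eq_one.1 h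
  refine ⟨n, ?_⟩
  push_cast
  linarith

theorem midpoint_fst (j : Fin 3) : (D.f j midpoint).1.1 = 1 / 2 := by
  rw [D.f_lift]
  simp [midpoint]
  ring

theorem exists_windings (ht : t ≠ 0) (hr : 0 < r) (hr' : r < 1 / 2) :
    ∃ (w w' : ChainsModBoundaries (compactCurve t) →ₗ[ℤ] ℝ) (a b c d : ℤ),
      w (homologyToChains _ D.A) = (2 * a + 1 : ℤ) * (2 * Real.pi) ∧
      w (homologyToChains _ D.B) = (2 * b : ℤ) * (2 * Real.pi) ∧
      w' (homologyToChains _ D.A) = (2 * c + 1 : ℤ) * (2 * Real.pi) ∧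
      w' (homologyToChains _ D.B) = (2 * d + 1 : ℤ) * (2 * Real.pi) := by
  obtain ⟨e, he, he1, he3⟩ := exists_cube_root_quarter
  have he0 : (e : ℂ) ≠ 0 := Complex.ofReal_ne_zero.2 he.ne'
  have he3' : (e : ℂ) ^ 3 = 1 / 4 := by
    rw [← Complex.ofReal_pow, he3]
    norm_num
  set ζ := (D.f 0 midpoint).1.2 with hζ
  have hζ3 : ζ ^ 3 = t / 4 := by
    rw [hζ, affineCurve_iff.1 (D.f 0 midpoint).2, D.midpoint_fst]
    ring
  have hζ0 : ζ ≠ 0 := fun h => ht (by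
    rw [h] at hζ3
    linear_combination -4 * hζ3)
  have hj : ∀ j : Fin 3, (D.f j midpoint).1.2 = ε ^ (j : ℕ) * ζ := fun j => D.f_sheet j midpoint
  -- With κ = ζ/e the midpoints of the three sheets have x = e, εe, ε²e, where e³ = 1/4 is the value
  -- of z(1 - z) at 1/2. Replacing κ by εκ turns these into ε²e, e, εe, which moves the special
  -- sheet from the first to the second.
  have hκ : (ζ / e) ^ 3 = t := by
    rw [div_pow, hζ3, he3']
    ring
  have hκ' : (ε * (ζ / e)) ^ 3 = t := by rw [mul_pow, ε_pow_three, one_mul, hκ]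
  have hε : ε ≠ 0 := Complex.exp_ne_zero _
  have m0 := circleMap_eq_one hκ ht he (D.midpoint_fst 0) (by
    rw [hj]
    simp
    field_simp)
  have m1 := circleMap_eq_neg_one hκ ht he he1 (D.midpoint_fst 1) (Or.inl (by
    rw [hj]
    simp
    field_simp))
  have m2 := circleMap_eq_neg_one hκ ht he he1 (D.midpoint_fst 2) (Or.inr (by
    rw [hj]
    simp
    field_simp))
  have m0' := circleMap_eq_neg_one hκ' ht he he1 (D.midpoint_fst 0) (Or.inr (by
    rw [hj]
    simp
    field_simp
    rw [ε_pow_three]))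
  have m1' := circleMap_eq_one hκ' ht he (D.midpoint_fst 1) (by
    rw [hj]
    simp
    field_simp)
  have m2' := circleMap_eq_neg_one hκ' ht he he1 (D.midpoint_fst 2) (Or.inl (by
    rw [hj]
    simp
    field_simp))
  have hA := D.exp_half_winding_A hκ ht hr hr'
  have hB := D.exp_half_winding_B hκ ht hr hr'
  have hA' := D.exp_half_winding_A hκ' ht hr hr'
  have hB' := D.exp_half_winding_B hκ' ht hr hr'
  rw [m0, m1, div_one] at hA
  rw [m1, m2, div_self'] at hB
  have hneg : (1 : Circle) / -1 = -1 := Circle.ext (by simp)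
  rw [m0', m1', hneg] at hA'
  rw [m1', m2', div_one] at hB'
  obtain ⟨a, ha⟩ := exists_odd_of_exp_half hA
  obtain ⟨b, hb⟩ := exists_even_of_exp_half hB
  obtain ⟨c, hc⟩ := exists_odd_of_exp_half hA'
  obtain ⟨d, hd⟩ := exists_odd_of_exp_half hB'
  exact ⟨_, _, a, b, c, d, ha, hb, hc, hd⟩

theorem linearIndependent (ht : t ≠ 0) (hr : 0 < r) (hr' : r < 1 / 2) :
    LinearIndependent ℤ ![D.A, D.B] := by
  obtain ⟨w, w', a, b, c, d, ha, hb, hc, hd⟩ := D.exists_windings ht hr hr'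
  rw [LinearIndependent.pair_iff]
  intro m n h
  have key : ∀ (v : ChainsModBoundaries (compactCurve t) →ₗ[ℤ] ℝ) (k l : ℤ),
      v (homologyToChains _ D.A) = k * (2 * Real.pi) →
      v (homologyToChains _ D.B) = l * (2 * Real.pi) → m * k + n * l = 0 := by
    intro v k l hk hl
    have h1 := congrArg (fun x => v (homologyToChains _ x)) h
    have hs := fun (c : ℤ) (x : H1 (compactCurve t)) =>
      ((v.comp (homologyToChains _)).map_smul c x).trans (zsmul_eq_mul _ _)
    simp only [LinearMap.comp_apply] at hs
    simp only [map_add, map_zero, hs, hk, hl] at h1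
    have h2 : ((m * k + n * l : ℤ) : ℝ) * (2 * Real.pi) = 0 := by
      rw [← h1]
      push_cast
      ring
    exact_mod_cast (mul_eq_zero.1 h2).resolve_right (by positivity)
  have h1 := key w _ _ ha hb
  have h2 := key w' _ _ hc hd
  -- Cramer's rule; the determinant is odd, hence nonzero.
  have h3 : m * ((2 * a + 1) * (2 * d + 1) - 2 * b * (2 * c + 1)) = 0 := by
    linear_combination (2 * d + 1) * h1 - 2 * b * h2
  have hm : m = 0 := by
    refine (mul_eq_zero.1 h3).resolve_right fun h4 => ?_
    have : 2 * (2 * a * d + a + d - b * (2 * c + 1)) = -1 := by linear_combination h4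
    omega
  refine ⟨hm, ?_⟩
  rw [hm, zero_mul, zero_add] at h2
  refine (mul_eq_zero.1 h2).resolve_right (by omega)

end SheetLifts

end Independence

/-! ### Existence of the sheet lifts. -/

section Existence

variable {t κ : ℂ}

/-- The sheets of the spectral curve, in terms of principal cube roots. -/
theorem sheet_mem (hκ : κ ^ 3 = t) (j : ℕ) (z : ℂ) :
    (z, κ * ε ^ j * cbrt z * cbrt (1 - z)) ∈ affineCurve t := by
  rw [affineCurve_iff]
  simp only [mul_pow, cbrt_pow, hκ]
  rw [← pow_mul, mul_comm j, pow_mul, ε_pow_three]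
  ring

/-- A path on the spectral curve given by its coordinates. -/
def curvePath {z ζ : unitInterval → ℂ} (hz : Continuous z) (hζ : Continuous ζ)
    (h : ∀ s, (z s, ζ s) ∈ affineCurve t) {p q : affineCurve t}
    (h0 : (z 0, ζ 0) = p.1) (h1 : (z 1, ζ 1) = q.1) : Path p q where
  toFun s := ⟨(z s, ζ s), h s⟩
  continuous_toFun := (hz.prodMk hζ).subtype_mk _
  source' := Subtype.ext h0
  target' := Subtype.ext h1

/-- The circle around `0` of radius `r`. -/
def circleZero (r : ℝ) (s : unitInterval) : ℂ :=
  r * Complex.exp (2 * Real.pi * Complex.I * (s : ℝ))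

theorem continuous_circleZero (r : ℝ) : Continuous (circleZero r) := by
  unfold circleZero
  fun_prop

theorem circleZero_zero (r : ℝ) : circleZero r 0 = r := by simp [circleZero]

theorem circleZero_one (r : ℝ) : circleZero r 1 = r := by simp [circleZero, Complex.exp_two_pi_mul_I]

/-- The values of `ζ` along the lifts of the circles. -/
def circleLift (κ : ℂ) (r : ℝ) (j : ℕ) (s : unitInterval) : ℂ :=
  -- The factor exp(2πis/3) continues the cube root of exp(2πis) and gains ε in one turn, passing to
  -- the next sheet; the cube root of 1 - z stays on its principal branch.
  κ * (ε ^ j * Complex.exp (2 * Real.pi * Complex.I / 3 * (s : ℝ))) * cbrt r *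
    cbrt (1 - circleZero r s)

theorem continuous_circleLift {r : ℝ} (hr : 0 < r) (hr' : r < 1 / 2) (j : ℕ) :
    Continuous (circleLift κ r j) := by
  refine Continuous.mul (by fun_prop) (continuousOn_cbrt.comp_continuous
    (continuous_const.sub (continuous_circleZero r)) fun s => ?_)
  exact one_sub_mem_slitPlane (SheetLifts.circle_norm_lt hr hr' s)

theorem circleLift_zero (r : ℝ) (j : ℕ) :
    circleLift κ r j 0 = κ * ε ^ j * cbrt r * cbrt (1 - r) := by
  simp [circleLift, circleZero_zero]

theorem circleLift_one (r : ℝ) (j : ℕ) :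
    circleLift κ r j 1 = κ * ε ^ (j + 1) * cbrt r * cbrt (1 - r) := by
  simp [circleLift, circleZero_one, pow_succ, ε]

theorem circleLift_pow (hκ : κ ^ 3 = t) (r : ℝ) (j : ℕ) (s : unitInterval) :
    circleLift κ r j s ^ 3 = t * (circleZero r s * (1 - circleZero r s)) := by
  have h : Complex.exp (2 * Real.pi * Complex.I / 3 * (s : ℝ)) ^ 3 =
      Complex.exp (2 * Real.pi * Complex.I * (s : ℝ)) := by
    rw [← Complex.exp_nat_mul]
    congr 1
    push_cast
    ring
  simp only [circleLift, mul_pow, cbrt_pow, hκ, h]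
  rw [← pow_mul, mul_comm j, pow_mul, ε_pow_three, circleZero]
  ring

/-- The segment from `1 - r` to `r`. -/
def segmentPoint (r : ℝ) (s : unitInterval) : ℂ :=
  (1 - (s : ℝ)) * (1 - r) + (s : ℝ) * r

theorem segmentPoint_eq (r : ℝ) (s : unitInterval) :
    segmentPoint r s = (((1 - (s : ℝ)) * (1 - r) + (s : ℝ) * r : ℝ) : ℂ) := by
  rw [segmentPoint]
  push_cast
  ring

theorem continuous_segmentLift {r : ℝ} (hr : 0 < r) (hr' : r < 1 / 2) (j : ℕ) :
    Continuous fun s => κ * ε ^ j * cbrt (segmentPoint r s) * cbrt (1 - segmentPoint r s) := by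
  have hc : Continuous (segmentPoint r) := by
    unfold segmentPoint
    fun_prop
  refine Continuous.mul (Continuous.mul continuous_const
    (continuousOn_cbrt.comp_continuous hc fun s => ?_))
    (continuousOn_cbrt.comp_continuous (continuous_const.sub hc) fun s => ?_)
  · rw [segmentPoint_eq, Complex.ofReal_mem_slitPlane]
    nlinarith [s.2.1, s.2.2]
  · rw [segmentPoint_eq, ← Complex.ofReal_one, ← Complex.ofReal_sub, Complex.ofReal_mem_slitPlane]
    nlinarith [s.2.1, s.2.2]

theorem nonempty_sheetLifts {r : ℝ} (hr : 0 < r) (hr' : r < 1 / 2) :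
    Nonempty (SheetLifts t r) := by
  have hκ : cbrt t ^ 3 = t := cbrt_pow t
  have hz : Continuous (segmentPoint r) := by
    unfold segmentPoint
    fun_prop
  have hm0 : ∀ (j : ℕ) s, (circleZero r s, circleLift (cbrt t) r j s) ∈ affineCurve t :=
    fun j s => affineCurve_iff.2 (circleLift_pow hκ r j s)
  -- The reflection z ↦ 1 - z preserves the curve, so the same ζ serves for the circle around 1.
  have hm1 : ∀ (j : ℕ) s, (1 - circleZero r s, circleLift (cbrt t) r j s) ∈ affineCurve t :=
    fun j s => affineCurve_iff.2 (by rw [circleLift_pow hκ r j s]; ring)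
  let p : Fin 3 → affineCurve t := fun j => ⟨_, sheet_mem hκ j r⟩
  let q : Fin 3 → affineCurve t := fun j => ⟨_, sheet_mem hκ j (1 - r)⟩
  have hc1 : Continuous fun s => 1 - circleZero r s :=
    continuous_const.sub (continuous_circleZero r)
  exact ⟨{
    p := p
    q := q
    f := fun j => curvePath hz (continuous_segmentLift hr hr' j) (fun s => sheet_mem hκ j _)
      (by simp [segmentPoint, q]) (by simp [segmentPoint, p])
    f_lift := fun j s => rfl
    f_sheet := fun j s => by
      change _ * ε ^ (j : ℕ) * _ * _ = ε ^ (j : ℕ) * (_ * ε ^ 0 * _ * _)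
      ring
    γ0 := curvePath (continuous_circleZero r) (continuous_circleLift hr hr' 0) (hm0 0)
      (by simp [circleZero_zero, circleLift_zero, p]) (by simp [circleZero_one, circleLift_one, p])
    γ0_lift := fun s => rfl
    γ0' := curvePath (continuous_circleZero r) (continuous_circleLift hr hr' 1) (hm0 1)
      (by simp [circleZero_zero, circleLift_zero, p]) (by simp [circleZero_one, circleLift_one, p])
    γ0'_lift := fun s => rfl
    γ1 := curvePath hc1 (continuous_circleLift hr hr' 0) (hm1 0)
      (by simp [circleZero_zero, circleLift_zero, q, mul_right_comm])
      (by simp [circleZero_one, circleLift_one, q, mul_right_comm])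
    γ1_lift := fun s => rfl
    γ1' := curvePath hc1 (continuous_circleLift hr hr' 1) (hm1 1)
      (by simp [circleZero_zero, circleLift_zero, q, mul_right_comm])
      (by simp [circleZero_one, circleLift_one, q, mul_right_comm])
    γ1'_lift := fun s => rfl }⟩

end Existence

end SpectralCurve

end

theorem mainTheorem10 (t : ℂ) (ht : t ≠ 0) (r : ℝ) (hr : 0 < r) (hr' : r < 1 / 2) :
    Nonempty (SpectralCurve.SheetLifts t r) ∧
      ∀ D : SpectralCurve.SheetLifts t r,
        ∃ b : Module.Basis (Fin 2) ℤ (SpectralCurve.H1 (SpectralCurve.compactCurve t)),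
          b 0 = D.A ∧ b 1 = D.B := by
  refine ⟨SpectralCurve.nonempty_sheetLifts hr hr', fun D =>
    ⟨Module.Basis.mk (D.linearIndependent ht hr hr') (D.span_eq_top ht hr hr').ge, ?_, ?_⟩⟩
  · simp
  · simp
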